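/- Let $d \ge 1$ and let $p(\xi) = \sum_{j=1}^d p_j(\xi_j)$, $\xi \in \mathbf R^d$, where $p_j(\xi_j) = \sum_{k=0}^{m_j} c_{j,k} \xi_j^k$ are one-variable polynomials of degree $m_j$ with real coefficients, such that $m := \max_j m_j \ge 2$. Let $P_m(\xi) = \sum_{j : m_j = m} c_{j,m} \xi_j^m$ be the principal part of $p$, and $$\chi_t(x,\xi) = (x + t \nabla P_m(\xi), \xi), \qquad t \in \mathbf R, \ (x,\xi) \in \mathbf R^{2d},$$ its Hamilton flow. Let $v \in \mathbf R^d$ have nonzero entries, let $q_j$ be polynomials with $q_j' = p_j$, and put $$\varphi_t(\xi) = \sum_{j=1}^d v_j^{-1} \left( q_j(\xi_j - t v_j) - q_j(\xi_j) \right), \qquad \mathscr K_t u = e^{-it\langle \cdot, v \rangle} \mathscr F^{-1}\left( e^{i \varphi_t} \widehat u \right), \quad u \in \mathscr S'(\mathbf R^d), \ t \in \mathbf R,$$ where $\widehat u = \mathscr F u$ and, for $u \in \mathscr S(\mathbf R^d)$, $\mathscr F u(\xi) = (2\pi)^{-d/2} \int_{\mathbf R^d} u(x) e^{-i \langle x,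 \xi\rangle} \, dx$. The operator $\mathscr K_t$ is the solution operator of the Airy--Schrödinger equation: for every $u_0 \in \mathscr S'(\mathbf R^d)$ the function $u(t) = \mathscr K_t u_0$ satisfies $$\partial_t u + i (p(D) + \langle v, x \rangle) u = 0, \quad t \in \mathbf R, \qquad u(0) = u_0,$$ in $\mathscr S'(\mathbf R^d)$ with the weak$^*$ topology, where $D_j = -i \partial_j$. For $\sigma > 0$, $u \in \mathscr S'(\mathbf R^d)$ and a window $\phi \in \mathscr S(\mathbf R^d) \setminus 0$ let $$V_\phi u(x,\xi) = (2\pi)^{-d/2} \left( u, e^{i\langle \cdot, \xi \rangle} \phi(\cdot - x) \right), \qquad x, \xi \in \mathbf R^d,$$ where the pairing is conjugate linear in the second argument, and let $\mathrm{WF}_g^\sigma(u) \subseteq \mathbf R^{2d} \setminus 0$ be the set of all $z_0 \ne 0$ that have no open neighbourhood $U \subseteq \mathbf R^{2d}$ with $$\sup_{(x,\xi) \in U, \ \lambda > 0} \lambda^N |V_\phi u(\lambda x, \lambda^\sigma \xi)| < \infty \quad \text{for all } N \ge 0.$$ Then for all $t \in \mathbf R$ and $u \in \mathscr S'(\mathbf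 R^d)$ $$\mathrm{WF}_g^\sigma(\mathscr K_t u) = \chi_t\left( \mathrm{WF}_g^\sigma(u) \right) \quad \text{if } \sigma = \frac{1}{m-1},$$ $$\mathrm{WF}_g^\sigma(\mathscr K_t u) = \mathrm{WF}_g^\sigma(u) \quad \text{if } 0 < \sigma < \frac{1}{m-1},$$ whichever windows, possibly different, are used for the wave front sets on the two sides. -/

import Mathlib

open scoped SchwartzMap LineDeriv Polynomial

noncomputable section

namespace AirySchrodinger

/-- `ℝᵈ` with the Euclidean norm. Phase space `T*ℝᵈ` is `Rd d × Rd d`. -/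
abbrev Rd (d : ℕ) : Type := EuclideanSpace ℝ (Fin d)

/-! ### Oscillating factors

`SchwartzMap.smulLeftCLM g` and `TemperedDistribution.smulLeftCLM g` are multiplication by `g` when
`g` has temperate growth (and zero otherwise); the next facts show that every multiplier used
below has temperate growth. -/

theorem hasTemperateGrowth_cexp_ofReal_mul_I :
    (fun s : ℝ => Complex.exp (s * Complex.I)).HasTemperateGrowth := by
  have hd : ∀ n : ℕ, iteratedDeriv n (fun s : ℝ => Complex.exp (s * Complex.I)) =
      fun s : ℝ => Complex.I ^ n * Complex.exp (s * Complex.I) := by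
    intro n
    induction n with
    | zero => simp
    | succ n ih =>
      rw [iteratedDeriv_succ, ih]
      funext s
      have h1 : HasDerivAt (fun s : ℝ => (s : ℂ) * Complex.I) (1 * Complex.I) s :=
        (Complex.ofRealCLM.hasDerivAt (x := s)).mul_const Complex.I
      have h2 := (h1.cexp).const_mul (Complex.I ^ n)
      rw [h2.deriv]
      ring
  refine ⟨(Complex.ofRealCLM.contDiff.mul contDiff_const).cexp, fun n => ⟨0, 1, fun s => ?_⟩⟩
  rw [norm_iteratedFDeriv_eq_norm_iteratedDeriv, hd]
  simp [Complex.norm_exp_ofReal_mul_I]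

theorem hasTemperateGrowth_cexp {d : ℕ} {g : Rd d → ℝ} (hg : g.HasTemperateGrowth) :
    (fun x => Complex.exp (g x * Complex.I)).HasTemperateGrowth :=
  hasTemperateGrowth_cexp_ofReal_mul_I.comp hg

/-! ### The short-time Fourier transform and the anisotropic Gabor wave front set -/

/-- Complex conjugation of a Schwartz function. -/
def conjS {d : ℕ} (f : 𝓢(Rd d, ℂ)) : 𝓢(Rd d, ℂ) :=
  SchwartzMap.postcompCLM (𝕜 := ℝ) Complex.conjCLE.toContinuousLinearMap f

/-- Modulation `M_ξ f (y) = e^{i⟨y, ξ⟩} f (y)` of a Schwartz function. -/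
def modulation {d : ℕ} (ξ : Rd d) : 𝓢(Rd d, ℂ) →L[ℂ] 𝓢(Rd d, ℂ) :=
  SchwartzMap.smulLeftCLM ℂ (fun y : Rd d => Complex.exp ((inner ℝ y ξ : ℝ) * Complex.I))

/-- The time-frequency shift `M_ξ T_x φ`, that is `y ↦ e^{i⟨y, ξ⟩} φ (y - x)`. -/
def timeFreqShift {d : ℕ} (φ : 𝓢(Rd d, ℂ)) (x ξ : Rd d) : 𝓢(Rd d, ℂ) :=
  modulation ξ (SchwartzMap.compSubConstCLM ℂ x φ)

theorem timeFreqShift_apply {d : ℕ} (φ : 𝓢(Rd d, ℂ)) (x ξ y : Rd d) :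
    timeFreqShift φ x ξ y = Complex.exp ((inner ℝ y ξ : ℝ) * Complex.I) * φ (y - x) := by
  rw [timeFreqShift, modulation, SchwartzMap.smulLeftCLM_apply_apply
    (hasTemperateGrowth_cexp (by fun_prop))]
  simp

/-- The short-time Fourier transform `V_φ u (x, ξ) = (2π)^{-d/2} (u, M_ξ T_x φ)`. The pairing
`(u, f)` is the one conjugate linear in `f`, that is `u` applied to the conjugate of `f`. -/
def stft {d : ℕ} (φ : 𝓢(Rd d, ℂ)) (u : 𝓢'(Rd d, ℂ)) (x ξ : Rd d) : ℂ :=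
  (((2 * Real.pi) ^ (-(d : ℝ) / 2) : ℝ) : ℂ) * u (conjS (timeFreqShift φ x ξ))

/-- The `σ`-anisotropic Gabor wave front set of `u`, a subset of `T*ℝᵈ \ 0`, computed with the
window `φ`: a point `z₀ ≠ 0` is outside of it iff `λ ^ N |V_φ u (λ x, λ ^ σ ξ)|` is bounded over
`(x, ξ) ∈ U` and `λ > 0` for every `N`, for some open `U ∋ z₀`. -/
def gaborWF {d : ℕ} (σ : ℝ) (φ : 𝓢(Rd d, ℂ)) (u : 𝓢'(Rd d, ℂ)) : Set (Rd d × Rd d) :=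
  {z₀ | z₀ ≠ 0 ∧ ¬ ∃ U : Set (Rd d × Rd d), IsOpen U ∧ z₀ ∈ U ∧
    ∀ N : ℕ, ∃ C : ℝ, ∀ z ∈ U, ∀ r : ℝ, 0 < r →
      r ^ N * ‖stft φ u (r • z.1) (r ^ σ • z.2)‖ ≤ C}

/-! ### The polynomial, its principal part and the Hamilton flow of the latter

A separable polynomial `p(ξ) = ∑ⱼ pⱼ(ξⱼ)` is given by the family `pⱼ` of one variable real
polynomials. -/

/-- The order `max_j deg p_j`. -/
def order {d : ℕ} (p : Fin d → ℝ[X]) : ℕ :=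
  Finset.univ.sup fun j => (p j).natDegree

/-- The principal part `P_m(ξ) = ∑_{j : deg p_j = m} c_{j,m} ξ_j ^ m`, `m` the order of `p`. -/
def principalPart {d : ℕ} (p : Fin d → ℝ[X]) (ξ : Rd d) : ℝ :=
  ∑ j with (p j).natDegree = order p, (p j).coeff (order p) * ξ j ^ order p

/-- The Hamilton flow `χ_t(x, ξ) = (x + t ∇P_m(ξ), ξ)` of the principal part. -/
def hamiltonFlow {d : ℕ} (p : Fin d → ℝ[X]) (t : ℝ) (z : Rd d × Rd d) : Rd d × Rd d :=
  (z.1 + t • gradient (principalPart p) z.2, z.2)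

/-! ### The evolution equation -/

/-- `D_j = -i ∂_j` on tempered distributions. -/
def opD {d : ℕ} (j : Fin d) (u : 𝓢'(Rd d, ℂ)) : 𝓢'(Rd d, ℂ) :=
  (-Complex.I) • ∂_{(EuclideanSpace.single j (1 : ℝ) : Rd d)} u

/-- The Hamiltonian `p(D) + ⟨v, x⟩` with `p(D) = ∑ⱼ pⱼ(Dⱼ)`, on tempered distributions. -/
def hamiltonian {d : ℕ} (p : Fin d → ℝ[X]) (v : Rd d) (u : 𝓢'(Rd d, ℂ)) : 𝓢'(Rd d, ℂ) :=
  (∑ j, (p j).sum fun k c => (c : ℂ) • (opD j)^[k] u) +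
    TemperedDistribution.smulLeftCLM ℂ (fun x : Rd d => ((inner ℝ v x : ℝ) : ℂ)) u

/-- `u` solves `∂_t u + i (p(D) + ⟨v, x⟩) u = 0`, `u(0) = u₀`, on the whole time axis in the space
of tempered distributions with its weak-* topology. -/
def IsSolution {d : ℕ} (p : Fin d → ℝ[X]) (v : Rd d) (u₀ : 𝓢'(Rd d, ℂ))
    (u : ℝ → 𝓢'(Rd d, ℂ)) : Prop :=
  u 0 = u₀ ∧ ∀ (t : ℝ) (f : 𝓢(Rd d, ℂ)),
    HasDerivAt (fun s => u s f) (-(Complex.I * hamiltonian p v (u t) f)) t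

/-- The phase function `φ_t(ξ) = ∑ⱼ vⱼ⁻¹ (qⱼ(ξⱼ - t vⱼ) - qⱼ(ξⱼ))`. -/
def phase {d : ℕ} (q : Fin d → ℝ[X]) (v : Rd d) (t : ℝ) (ξ : Rd d) : ℝ :=
  ∑ j, (v j)⁻¹ * ((q j).eval (ξ j - t * v j) - (q j).eval (ξ j))

/-- The propagator `K_t u = M_{-tv} F⁻¹(e^{iφ_t} F u)` on tempered distributions. Mathlib's Fourier
transform has the kernel `e^{-2πi⟨x, η⟩}`, so that the frequency `ξ` is `2πη`. -/
def propagator {d : ℕ} (q : Fin d → ℝ[X]) (v : Rd d) (t : ℝ) (u : 𝓢'(Rd d, ℂ)) : 𝓢'(Rd d, ℂ) :=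
  TemperedDistribution.smulLeftCLM ℂ
    (fun x : Rd d => Complex.exp ((inner ℝ x (-(t • v)) : ℝ) * Complex.I))
    (TemperedDistribution.fourierMultiplierCLM ℂ
      (fun η : Rd d => Complex.exp ((phase q v t ((2 * Real.pi) • η) : ℝ) * Complex.I)) u)

theorem hasTemperateGrowth_polynomial_eval (q : ℝ[X]) :
    (fun s : ℝ => q.eval s).HasTemperateGrowth := by
  simp only [Polynomial.eval_eq_sum, Polynomial.sum_def]
  exact Function.HasTemperateGrowth.sum fun n _ =>
    (Function.HasTemperateGrowth.const _).mul (Function.HasTemperateGrowth.id'.pow n)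

theorem hasTemperateGrowth_phase {d : ℕ} (q : Fin d → ℝ[X]) (v : Rd d) (t : ℝ) :
    (phase q v t).HasTemperateGrowth := by
  have hc : ∀ j : Fin d, (fun ξ : Rd d => ξ j).HasTemperateGrowth := fun j =>
    (EuclideanSpace.proj (𝕜 := ℝ) j : Rd d →L[ℝ] ℝ).hasTemperateGrowth
  unfold phase
  exact Function.HasTemperateGrowth.sum fun j _ =>
    (Function.HasTemperateGrowth.const _).mul
      (((hasTemperateGrowth_polynomial_eval (q j)).comp
        ((hc j).sub (Function.HasTemperateGrowth.const _))).sub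
        ((hasTemperateGrowth_polynomial_eval (q j)).comp (hc j)))

theorem hasTemperateGrowth_symbol {d : ℕ} (q : Fin d → ℝ[X]) (v : Rd d) (t : ℝ) :
    (fun η : Rd d => Complex.exp ((phase q v t ((2 * Real.pi) • η) : ℝ) * Complex.I)
      ).HasTemperateGrowth :=
  hasTemperateGrowth_cexp ((hasTemperateGrowth_phase q v t).comp
    (f := fun η : Rd d => (2 * Real.pi) • η)
    (((2 * Real.pi) • ContinuousLinearMap.id ℝ (Rd d)).hasTemperateGrowth))

end AirySchrodinger

end

noncomputable section

set_option maxSynthPendingDepth 3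

namespace AirySchrodinger

open MeasureTheory Filter Topology
open scoped FourierTransform BoundedContinuousFunction

/-! ### Continuous functionals on Schwartz space and absolutely convergent integrals. -/

section

variable {E : Type*} [NormedAddCommGroup E] [NormedSpace ℝ E]

/-! The short-time Fourier transform turns `K_t` into an integral operator on phase space whose
kernel consists of the matrix coefficients of `K_t` between wave packets. On the Fourier side `K_t`
is a unimodular multiplier combined with a translation, so the coefficients can be computed. Expand
`φ_t` at `ζ = ξ + tv`: the constant term drops out of the modulus, the linear term displaces the
packet by `∇φ_t(ζ)`, and the remainder stays in the amplitude. Thus `V(K_t u)(x, ξ)` is an average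
of `V u` around `(x + ∇φ_t(ζ), ζ)`, with a weight that is the Fourier transform of an amplitude
(`norm_pairCLM_propagatorS`, `apply_eq_integral_pairCLM`).

The decisive estimate is the concentration of that weight. Since `φ_t` is made of differences of
polynomials of degree at most `m + 1`, its Taylor coefficients of order at least two are `O(L)` with
`L = (1 + |ζ|)^(m-2)`. Each power of decay in position therefore costs at most a factor `L`
(`exists_norm_fourier_amplitude_le`). At the scale `|x| ~ λ`, `|ξ| ~ λ^σ`, the hypothesis `σ(m - 1)
≤ 1` gives `L λ^σ ≲ λ`: the spread `L` is smaller than `λ` by a factor `λ^σ`, and enough powers of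
this gain beat any power of `λ`. So only an anisotropic conic neighbourhood of the displaced point
matters (`exists_pow_mul_norm_stft_propagator_le`).

The displacement has a limit after rescaling: `λ⁻¹ ∇φ_t(λ^σ ξ + tv)` tends to `-κ t ∇P_m(ξ)`, where
`κ = lim λ^(σ(m-1)-1)` is `1` in the critical case and `0` below it (`tendsto_flow`). This gives one
inclusion, and the group law of `K_t` gives the other (`gaborWF_propagator`).

The evolution equation rests on the same representation: `(K_t u)(f)` is an absolutely convergent
phase space integral with locally uniform bounds in `t`, hence may be differentiated under the
integral sign (`hasDerivAt_propagator`). -/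

/-- The weighted derivative `x ↦ ‖x‖ ^ k • D ^ n f (x)` as a bounded continuous function. -/
def weightedDeriv (k n : ℕ) : 𝓢(E, ℂ) →L[ℂ] (E →ᵇ (E [×n]→L[ℝ] ℂ)) :=
  SchwartzMap.mkCLMtoNormedSpace (𝕜 := ℂ) (𝕜' := ℂ) (σ := RingHom.id ℂ) (D := E) (E := ℂ)
    (G := E →ᵇ (E [×n]→L[ℝ] ℂ))
    (fun f => BoundedContinuousFunction.ofNormedAddCommGroup
      (fun x => ((‖x‖ ^ k : ℝ) : ℂ) • iteratedFDeriv ℝ n f x)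
      ((Complex.continuous_ofReal.comp (continuous_norm.pow k)).smul
        ((f.smooth n).continuous_iteratedFDeriv le_rfl))
      (SchwartzMap.seminorm ℂ k n f)
      (fun x => by
        rw [norm_smul, Complex.norm_real, Real.norm_of_nonneg (by positivity)]
        exact f.le_seminorm ℂ k n x))
    (fun f g => by
      ext1 x
      have h := iteratedFDeriv_add_apply (𝕜 := ℝ) (x := x) (i := n) (f.contDiffAt n)
        (g.contDiffAt n)
      change ((‖x‖ ^ k : ℝ) : ℂ) • iteratedFDeriv ℝ n (⇑f + ⇑g) x = _
      rw [h, smul_add]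
      rfl)
    (fun c f => by
      ext1 x
      have h := iteratedFDeriv_const_smul_apply (𝕜 := ℝ) (x := x) (i := n) (a := c) (f.contDiffAt n)
      change ((‖x‖ ^ k : ℝ) : ℂ) • iteratedFDeriv ℝ n (c • ⇑f) x = _
      rw [h, smul_comm]
      rfl)
    ⟨{(k, n)}, 1, zero_le_one, fun f => by
      simp only [Finset.sup_singleton, SchwartzMap.schwartzSeminormFamily_apply, one_mul]
      exact BoundedContinuousFunction.norm_ofNormedAddCommGroup_le _ (apply_nonneg _ _) _⟩

theorem weightedDeriv_apply (k n : ℕ) (f : 𝓢(E, ℂ)) (x : E) :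
    weightedDeriv k n f x = ((‖x‖ ^ k : ℝ) : ℂ) • iteratedFDeriv ℝ n f x := rfl

theorem seminorm_le_norm_weightedDeriv (k n : ℕ) (f : 𝓢(E, ℂ)) :
    SchwartzMap.seminorm ℂ k n f ≤ ‖weightedDeriv k n f‖ := by
  refine f.seminorm_le_bound ℂ k n (norm_nonneg _) fun x => ?_
  have := (weightedDeriv k n f).norm_coe_le_norm x
  rwa [weightedDeriv_apply, norm_smul, Complex.norm_real, Real.norm_of_nonneg (by positivity)]
    at this

theorem norm_weightedDeriv_le (k n : ℕ) (f : 𝓢(E, ℂ)) :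
    ‖weightedDeriv k n f‖ ≤ SchwartzMap.seminorm ℂ k n f := by
  refine (BoundedContinuousFunction.norm_le (apply_nonneg _ _)).2 fun x => ?_
  rw [weightedDeriv_apply, norm_smul, Complex.norm_real, Real.norm_of_nonneg (by positivity)]
  exact f.le_seminorm ℂ k n x

/-- A functional that is dominated by the norm of a linear map factors through it. -/
theorem exists_factor {S B : Type*} [AddCommGroup S] [Module ℂ S] [NormedAddCommGroup B]
    [NormedSpace ℂ B] (ι : S →ₗ[ℂ] B) (u : S →ₗ[ℂ] ℂ) (C : ℝ) (h : ∀ f, ‖u f‖ ≤ C * ‖ι f‖) :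
    ∃ U : B →L[ℂ] ℂ, ∀ f, U (ι f) = u f := by
  have hker : LinearMap.ker ι ≤ LinearMap.ker u := fun f hf => by
    rw [LinearMap.mem_ker] at hf ⊢
    simpa [hf] using h f
  let u₀ : LinearMap.range ι →ₗ[ℂ] ℂ :=
    ((LinearMap.ker ι).liftQ u hker).comp ι.quotKerEquivRange.symm.toLinearMap
  have hu₀ : ∀ f, u₀ ⟨ι f, LinearMap.mem_range_self ι f⟩ = u f := fun f => by
    have : ι.quotKerEquivRange.symm ⟨ι f, LinearMap.mem_range_self ι f⟩
        = (LinearMap.ker ι).mkQ f := by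
      rw [LinearEquiv.symm_apply_eq]; rfl
    simp only [u₀, LinearMap.comp_apply, LinearEquiv.coe_coe, this]
    simp
  -- Hahn–Banach extends the functional from the range of `ι`, which need not be closed.
  obtain ⟨U, hU, -⟩ := exists_extension_norm_eq (LinearMap.range ι)
    (u₀.mkContinuous C (by
      rintro ⟨_, f, rfl⟩
      rw [hu₀]
      exact h f))
  exact ⟨U, fun f => (hU ⟨ι f, LinearMap.mem_range_self ι f⟩).trans (hu₀ f)⟩

section Integral

variable {Z : Type*} [TopologicalSpace Z] [MeasurableSpace Z] [OpensMeasurableSpace Z]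
  [SecondCountableTopology Z] {μ : Measure Z} {F : Z → 𝓢(E, ℂ)}

theorem integrable_weightedDeriv (hF : Continuous F)
    (hInt : ∀ k n, Integrable (fun z => SchwartzMap.seminorm ℂ k n (F z)) μ) (k n : ℕ) :
    Integrable (fun z => weightedDeriv k n (F z)) μ :=
  (hInt k n).mono' ((weightedDeriv k n).continuous.comp hF).aestronglyMeasurable
    (.of_forall fun _ => norm_weightedDeriv_le _ _ _)

theorem integrable_iteratedFDeriv (hF : Continuous F)
    (hInt : ∀ k n, Integrable (fun z => SchwartzMap.seminorm ℂ k n (F z)) μ) (n : ℕ) (x : E) :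
    Integrable (fun z => iteratedFDeriv ℝ n (F z) x) μ := by
  have := (BoundedContinuousFunction.evalCLM ℂ x).integrable_comp
    (integrable_weightedDeriv hF hInt 0 n)
  refine this.congr (.of_forall fun z => ?_)
  simp [weightedDeriv_apply]

/-- Differentiation under the integral sign, one order at a time; the seminorm of index `(0, n + 1)`
dominates the next derivative uniformly in the base point. -/
theorem iteratedFDeriv_integral (hF : Continuous F)
    (hInt : ∀ k n, Integrable (fun z => SchwartzMap.seminorm ℂ k n (F z)) μ) (n : ℕ) :
    iteratedFDeriv ℝ n (fun x => ∫ z, F z x ∂μ) =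
      fun x => ∫ z, iteratedFDeriv ℝ n (F z) x ∂μ := by
  induction n with
  | zero =>
    funext x
    have h := ((continuousMultilinearCurryFin0 ℝ E
        ℂ).symm.toContinuousLinearEquiv.toContinuousLinearMap).integral_comp_comm
        (φ := fun z => F z x) (μ := μ) (by
      have := ((continuousMultilinearCurryFin0 ℝ E
        ℂ).toContinuousLinearEquiv.toContinuousLinearMap).integrable_comp
          (integrable_iteratedFDeriv hF hInt 0 x)
      refine this.congr (.of_forall fun z => ?_)
      simp)
    exact h.symm
  | succ n ih =>
    funext x
    rw [iteratedFDeriv_succ_eq_comp_left, Function.comp_apply, ih]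
    have hd : HasFDerivAt (fun x => ∫ z, iteratedFDeriv ℝ n (F z) x ∂μ)
        (∫ z, fderiv ℝ (iteratedFDeriv ℝ n (F z)) x ∂μ) x := by
      refine hasFDerivAt_integral_of_dominated_of_fderiv_le (𝕜 := ℝ)
        (F' := fun y z => fderiv ℝ (iteratedFDeriv ℝ n (F z)) y)
        (bound := fun z => SchwartzMap.seminorm ℂ 0 (n + 1) (F z)) (s := Set.univ) Filter.univ_mem
        (.of_forall fun y => (integrable_iteratedFDeriv hF hInt n y).aestronglyMeasurable)
        (integrable_iteratedFDeriv hF hInt n x) ?_ (.of_forall fun z y _ => ?_) (hInt 0 (n + 1))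
        (.of_forall fun z y _ => ?_)
      · have := ((continuousMultilinearCurryLeftEquiv ℝ (fun _ : Fin (n + 1) => E) ℂ
          ).toContinuousLinearEquiv.toContinuousLinearMap).integrable_comp
          (integrable_iteratedFDeriv hF hInt (n + 1) x)
        refine (this.congr (.of_forall fun z => ?_)).aestronglyMeasurable
        simp [iteratedFDeriv_succ_eq_comp_left]
      · have := (F z).norm_iteratedFDeriv_le_seminorm ℂ (n + 1) y
        rwa [← norm_fderiv_iteratedFDeriv] at this
      · exact (((F z).smooth (n + 1 : ℕ)).differentiable_iteratedFDeriv
          (by exact_mod_cast Nat.lt_succ_self n) y).hasFDerivAt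
    rw [hd.fderiv]
    have hi : Integrable (fun z => fderiv ℝ (iteratedFDeriv ℝ n (F z)) x) μ := by
      have := ((continuousMultilinearCurryLeftEquiv ℝ (fun _ : Fin (n + 1) => E) ℂ
          ).toContinuousLinearEquiv.toContinuousLinearMap).integrable_comp
          (integrable_iteratedFDeriv hF hInt (n + 1) x)
      refine this.congr (.of_forall fun z => ?_)
      simp [iteratedFDeriv_succ_eq_comp_left]
    exact (((continuousMultilinearCurryLeftEquiv ℝ (fun _ : Fin (n + 1) => E) ℂ
          ).symm.toContinuousLinearEquiv.toContinuousLinearMap).integral_comp_comm hi).symm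

/-- A continuous functional on Schwartz space commutes with absolutely convergent integrals. -/
theorem apply_integral_eq (hF : Continuous F)
    (hInt : ∀ k n, Integrable (fun z => SchwartzMap.seminorm ℂ k n (F z)) μ) {f : 𝓢(E, ℂ)}
    (hf : ∀ x, f x = ∫ z, F z x ∂μ) (u : 𝓢(E, ℂ) →L[ℂ] ℂ) :
    u f = ∫ z, u (F z) ∂μ := by
  obtain ⟨s, C, -, hC⟩ := Seminorm.bound_of_continuous (schwartz_withSeminorms ℂ E ℂ)
    ((normSeminorm ℂ ℂ).comp u.toLinearMap) (continuous_norm.comp u.continuous)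
  -- Only finitely many seminorms control `u`, so `u` factors through a finite product of Banach
  -- spaces, where the Bochner integral is available.
  let ι : 𝓢(E, ℂ) →L[ℂ] ((i : s) → (E →ᵇ (E [×i.1.2]→L[ℝ] ℂ))) :=
    ContinuousLinearMap.pi fun i => weightedDeriv i.1.1 i.1.2
  obtain ⟨U, hU⟩ := exists_factor ι.toLinearMap u.toLinearMap C (fun f => by
    refine (hC f).trans ?_
    rw [_root_.smul_apply, NNReal.smul_def, smul_eq_mul]
    refine mul_le_mul_of_nonneg_left ?_ C.2
    refine Seminorm.finset_sup_apply_le (norm_nonneg _) fun i hi => ?_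
    exact (seminorm_le_norm_weightedDeriv i.1 i.2 f).trans (norm_le_pi_norm (ι f) ⟨i, hi⟩))
  have hι : Integrable (fun z => ι (F z)) μ :=
    Integrable.of_eval fun i => integrable_weightedDeriv hF hInt i.1.1 i.1.2
  -- Evaluation at points separates bounded continuous functions, which reduces the vector-valued
  -- identity to derivatives of the pointwise integral.
  have key : ι f = ∫ z, ι (F z) ∂μ := by
    funext i
    rw [eval_integral fun i => integrable_weightedDeriv hF hInt i.1.1 i.1.2]
    ext1 x
    have h1 := (BoundedContinuousFunction.evalCLM ℂ x).integral_comp_comm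
      (integrable_weightedDeriv hF hInt i.1.1 i.1.2)
    refine Eq.trans ?_ h1
    change weightedDeriv i.1.1 i.1.2 f x = ∫ z, weightedDeriv i.1.1 i.1.2 (F z) x ∂μ
    simp only [weightedDeriv_apply]
    rw [integral_smul, show (f : E → ℂ) = fun x => ∫ z, F z x ∂μ from funext hf,
      iteratedFDeriv_integral hF hInt]
  have h2 := U.integral_comp_comm hι
  rw [← key] at h2
  exact (hU f).symm.trans (h2.symm.trans (integral_congr_ae (.of_forall fun z => hU (F z))))

end Integral

end

/-! ### Translations on Schwartz space. -/

section

theorem norm_pow_le_of_sub {E : Type*} [SeminormedAddCommGroup E] (k : ℕ) (x y : E) :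
    ‖y‖ ^ k ≤ (1 + ‖x‖) ^ k * (1 + ‖y - x‖) ^ k := by
  rw [← mul_pow]
  refine pow_le_pow_left₀ (norm_nonneg _) ?_ k
  have h : ‖y‖ ≤ ‖y - x‖ + ‖x‖ := by simpa using norm_add_le (y - x) x
  nlinarith [norm_nonneg x, norm_nonneg (y - x), mul_nonneg (norm_nonneg x) (norm_nonneg (y - x))]

section Translation

variable {E : Type*} [NormedAddCommGroup E] [NormedSpace ℝ E]

theorem iteratedFDeriv_compSubConstCLM (f : 𝓢(E, ℂ)) (n : ℕ) (x y : E) :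
    iteratedFDeriv ℝ n (SchwartzMap.compSubConstCLM ℂ x f) y = iteratedFDeriv ℝ n f (y - x) := by
  have : (SchwartzMap.compSubConstCLM ℂ x f : E → ℂ) = fun y => f (y - x) := by
    funext y; simp
  rw [this]
  exact iteratedFDeriv_comp_sub n x y

theorem seminorm_compSubConstCLM_le (f : 𝓢(E, ℂ)) (k n : ℕ) (x : E) :
    SchwartzMap.seminorm ℂ k n (SchwartzMap.compSubConstCLM ℂ x f) ≤
      2 ^ k * (1 + ‖x‖) ^ k * (Finset.Iic (k, n)).sup (schwartzSeminormFamily ℂ E ℂ) f := by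
  refine SchwartzMap.seminorm_le_bound ℂ k n _ (by positivity) fun y => ?_
  rw [iteratedFDeriv_compSubConstCLM]
  have h1 := SchwartzMap.one_add_le_sup_seminorm_apply (𝕜 := ℂ) (m := (k, n)) le_rfl le_rfl f
    (y - x)
  calc ‖y‖ ^ k * ‖iteratedFDeriv ℝ n f (y - x)‖
      ≤ (1 + ‖x‖) ^ k * (1 + ‖y - x‖) ^ k * ‖iteratedFDeriv ℝ n f (y - x)‖ := by
        gcongr; exact norm_pow_le_of_sub k x y
    _ = (1 + ‖x‖) ^ k * ((1 + ‖y - x‖) ^ k * ‖iteratedFDeriv ℝ n f (y - x)‖) := by ring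
    _ ≤ (1 + ‖x‖) ^ k * (2 ^ k * (Finset.Iic (k, n)).sup (schwartzSeminormFamily ℂ E ℂ) f) :=
        mul_le_mul_of_nonneg_left h1 (by positivity)
    _ = _ := by ring

/-- Mean value inequality on the segment from `y` to `y - x`. Its length is at most one, so the
weights along it are comparable up to a factor `2`; this and the factor `2 ^ k` from the seminorm
bound make up `4 ^ k`. -/
theorem seminorm_compSubConstCLM_sub_le (f : 𝓢(E, ℂ)) (k n : ℕ) {x : E} (hx : ‖x‖ ≤ 1) :
    SchwartzMap.seminorm ℂ k n (SchwartzMap.compSubConstCLM ℂ x f - f) ≤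
      ‖x‖ * (4 ^ k * (Finset.Iic (k, n + 1)).sup (schwartzSeminormFamily ℂ E ℂ) f) := by
  refine SchwartzMap.seminorm_le_bound ℂ k n _ (by positivity) fun y => ?_
  have hsub : iteratedFDeriv ℝ n (SchwartzMap.compSubConstCLM ℂ x f - f : 𝓢(E, ℂ)) y =
      iteratedFDeriv ℝ n f (y - x) - iteratedFDeriv ℝ n f y := by
    rw [← iteratedFDeriv_compSubConstCLM]
    exact iteratedFDeriv_sub_apply ((SchwartzMap.compSubConstCLM ℂ x f).contDiffAt n)
      (f.contDiffAt n)
  set K : ℝ := 2 ^ k * (Finset.Iic (k, n + 1)).sup (schwartzSeminormFamily ℂ E ℂ) f with hK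
  have hmv : ‖iteratedFDeriv ℝ n f (y - x) - iteratedFDeriv ℝ n f y‖ ≤
      (2 ^ k * K / (1 + ‖y‖) ^ k) * ‖(y - x) - y‖ := by
    refine (convex_segment y (y - x)).norm_image_sub_le_of_norm_fderiv_le (𝕜 := ℝ)
      (f := iteratedFDeriv ℝ n f)
      (fun w _ => (f.smooth (n + 1 : ℕ)).differentiable_iteratedFDeriv
          (by exact_mod_cast Nat.lt_succ_self n) w) (fun w hw => ?_)
      (left_mem_segment ℝ _ _) (right_mem_segment ℝ _ _)
    rw [norm_fderiv_iteratedFDeriv, le_div_iff₀ (by positivity)]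
    have h1 := SchwartzMap.one_add_le_sup_seminorm_apply (𝕜 := ℂ) (m := (k, n + 1)) le_rfl le_rfl
      f w
    have hyw : ‖y - w‖ ≤ 1 := by
      rw [segment_eq_image'] at hw
      obtain ⟨θ, hθ, rfl⟩ := hw
      have : y - (y + θ • (y - x - y)) = θ • x := by module
      rw [this, norm_smul, Real.norm_of_nonneg hθ.1]
      exact mul_le_one₀ hθ.2 (norm_nonneg _) hx
    have h2 : 1 + ‖y‖ ≤ 2 * (1 + ‖w‖) := by
      have : ‖y‖ ≤ ‖y - w‖ + ‖w‖ := by simpa using norm_add_le (y - w) w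
      linarith [norm_nonneg w]
    calc ‖iteratedFDeriv ℝ (n + 1) f w‖ * (1 + ‖y‖) ^ k
        ≤ ‖iteratedFDeriv ℝ (n + 1) f w‖ * (2 * (1 + ‖w‖)) ^ k := by gcongr
      _ = 2 ^ k * ((1 + ‖w‖) ^ k * ‖iteratedFDeriv ℝ (n + 1) f w‖) := by rw [mul_pow]; ring
      _ ≤ 2 ^ k * K := by gcongr; exact h1
  rw [hsub]
  have hy : ‖y‖ ^ k ≤ (1 + ‖y‖) ^ k := by gcongr; linarith
  calc ‖y‖ ^ k * ‖iteratedFDeriv ℝ n f (y - x) - iteratedFDeriv ℝ n f y‖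
      ≤ (1 + ‖y‖) ^ k * ((2 ^ k * K / (1 + ‖y‖) ^ k) * ‖(y - x) - y‖) := by gcongr
    _ = ‖x‖ * (2 ^ k * K) := by
        rw [show y - x - y = -x by abel, norm_neg]; field_simp
    _ = _ := by rw [hK, show (4 : ℝ) = 2 * 2 by norm_num, mul_pow]; ring

theorem continuous_compSubConstCLM (f : 𝓢(E, ℂ)) :
    Continuous fun x : E => SchwartzMap.compSubConstCLM ℂ x f := by
  -- By the group law it suffices to treat the origin; translation by `x₀` carries the limit to
  -- `x₀`.
  have h0 : Tendsto (fun x : E => SchwartzMap.compSubConstCLM ℂ x f) (𝓝 0) (𝓝 f) := by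
    rw [(schwartz_withSeminorms ℂ E ℂ).tendsto_nhds]
    rintro ⟨k, n⟩ ε hε
    set K := (4 ^ k * (Finset.Iic (k, n + 1)).sup (schwartzSeminormFamily ℂ E ℂ) f)
    have ht : Tendsto (fun x : E => ‖x‖ * K) (𝓝 0) (𝓝 0) := by
      have : Continuous fun x : E => ‖x‖ * K := by fun_prop
      simpa using this.tendsto 0
    filter_upwards [ht.eventually_lt_const hε, Metric.ball_mem_nhds (0 : E) one_pos] with x hx hx1
    exact (seminorm_compSubConstCLM_sub_le f k n (by simpa using (mem_ball_zero_iff.1 hx1).le)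
      ).trans_lt hx
  rw [continuous_iff_continuousAt]
  intro x₀
  have h1 : Tendsto (fun x : E => x - x₀) (𝓝 x₀) (𝓝 0) := by
    have : Continuous fun x : E => x - x₀ := by fun_prop
    simpa using this.tendsto x₀
  have h2 := ((SchwartzMap.compSubConstCLM ℂ x₀ (F := ℂ)).continuous.tendsto f).comp (h0.comp h1)
  refine h2.congr fun x => ?_
  ext y
  simp

end Translation

/-! ### Time-frequency shifts and polynomial growth of the short-time Fourier transform. -/

variable {d : ℕ}

theorem modulation_apply (ξ : Rd d) (f : 𝓢(Rd d, ℂ)) (y : Rd d) :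
    modulation ξ f y = Complex.exp ((inner ℝ y ξ : ℝ) * Complex.I) * f y := by
  rw [modulation, SchwartzMap.smulLeftCLM_apply_apply (hasTemperateGrowth_cexp (by fun_prop))]
  simp

theorem fourier_apply_eq (f : 𝓢(Rd d, ℂ)) (η : Rd d) :
    𝓕 f η = ∫ x, Complex.exp ((-2 * Real.pi * inner ℝ x η : ℝ) * Complex.I) * f x := by
  rw [SchwartzMap.fourier_coe, Real.fourier_eq']
  simp

theorem fourierInv_apply_eq (f : 𝓢(Rd d, ℂ)) (η : Rd d) :
    𝓕⁻ f η = ∫ x, Complex.exp ((2 * Real.pi * inner ℝ x η : ℝ) * Complex.I) * f x := by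
  rw [SchwartzMap.fourierInv_coe, Real.fourierInv_eq']
  simp

theorem fourier_modulation (ξ : Rd d) (f : 𝓢(Rd d, ℂ)) :
    𝓕 (modulation ξ f) = SchwartzMap.compSubConstCLM ℂ ((2 * Real.pi)⁻¹ • ξ) (𝓕 f) := by
  ext η
  rw [SchwartzMap.compSubConstCLM_apply, fourier_apply_eq, fourier_apply_eq]
  refine integral_congr_ae (.of_forall fun x => ?_)
  simp only [modulation_apply]
  rw [← mul_assoc, ← Complex.exp_add]
  congr 2
  rw [inner_sub_right, inner_smul_right]
  push_cast
  field_simp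
  ring

theorem fourierInv_modulation (ξ : Rd d) (f : 𝓢(Rd d, ℂ)) :
    𝓕⁻ (modulation ξ f) = SchwartzMap.compSubConstCLM ℂ (-((2 * Real.pi)⁻¹ • ξ)) (𝓕⁻ f) := by
  ext η
  rw [SchwartzMap.compSubConstCLM_apply, fourierInv_apply_eq, fourierInv_apply_eq]
  refine integral_congr_ae (.of_forall fun x => ?_)
  simp only [modulation_apply]
  rw [← mul_assoc, ← Complex.exp_add]
  congr 2
  rw [inner_sub_right, inner_neg_right, inner_smul_right]
  push_cast
  field_simp
  ring

theorem fourier_compSubConstCLM (x : Rd d) (f : 𝓢(Rd d, ℂ)) :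
    𝓕 (SchwartzMap.compSubConstCLM ℂ x f) = modulation (-((2 * Real.pi) • x)) (𝓕 f) := by
  have h := fourierInv_modulation (-((2 * Real.pi) • x)) (𝓕 f)
  rw [FourierTransform.fourierInv_fourier_eq] at h
  have hx : -((2 * Real.pi)⁻¹ • -((2 * Real.pi) • x)) = x := by
    rw [smul_neg, neg_neg, smul_smul, inv_mul_cancel₀ (by positivity), one_smul]
  rw [hx] at h
  rw [← h, FourierTransform.fourier_fourierInv_eq]

theorem fourierInv_compSubConstCLM (x : Rd d) (f : 𝓢(Rd d, ℂ)) :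
    𝓕⁻ (SchwartzMap.compSubConstCLM ℂ x f) = modulation ((2 * Real.pi) • x) (𝓕⁻ f) := by
  have h := fourier_modulation ((2 * Real.pi) • x) (𝓕⁻ f)
  rw [FourierTransform.fourier_fourierInv_eq] at h
  have hx : (2 * Real.pi)⁻¹ • ((2 * Real.pi) • x) = x := by
    rw [smul_smul, inv_mul_cancel₀ (by positivity), one_smul]
  rw [hx] at h
  rw [← h, FourierTransform.fourierInv_fourier_eq]

/-- Fourier conjugation transfers the continuity and the seminorm bounds of translations to
modulations, without differentiating the exponential. -/
theorem modulation_eq (ξ : Rd d) (f : 𝓢(Rd d, ℂ)) :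
    modulation ξ f = 𝓕⁻ (SchwartzMap.compSubConstCLM ℂ ((2 * Real.pi)⁻¹ • ξ) (𝓕 f)) := by
  rw [← fourier_modulation, FourierTransform.fourierInv_fourier_eq]

theorem continuous_finset_sup_seminorm {E : Type*} [NormedAddCommGroup E] [NormedSpace ℝ E]
    (s : Finset (ℕ × ℕ)) : Continuous fun f => s.sup (schwartzSeminormFamily ℂ E ℂ) f := by
  induction s using Finset.cons_induction with
  | empty => exact continuous_const
  | cons i s hi ih =>
    simp only [Finset.sup_cons]
    exact ((schwartz_withSeminorms ℂ E ℂ).continuous_seminorm i).max ih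

/-- A continuous linear operator on Schwartz space is bounded by finitely many seminorms. -/
theorem exists_finset_seminorm_le {E : Type*} [NormedAddCommGroup E] [NormedSpace ℝ E]
    (A : 𝓢(E, ℂ) →L[ℂ] 𝓢(E, ℂ)) (s : Finset (ℕ × ℕ)) :
    ∃ (s' : Finset (ℕ × ℕ)) (C : ℝ), 0 ≤ C ∧ ∀ f,
      s.sup (schwartzSeminormFamily ℂ E ℂ) (A f) ≤
        C * s'.sup (schwartzSeminormFamily ℂ E ℂ) f := by
  obtain ⟨s', C, -, hC⟩ := Seminorm.bound_of_continuous (schwartz_withSeminorms ℂ E ℂ)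
    ((s.sup (schwartzSeminormFamily ℂ E ℂ)).comp A.toLinearMap)
    ((continuous_finset_sup_seminorm s).comp A.continuous)
  exact ⟨s', C, C.2, fun f => hC f⟩

theorem exists_finset_sup_compSubConstCLM_le (s : Finset (ℕ × ℕ)) :
    ∃ (s' : Finset (ℕ × ℕ)) (C : ℝ) (M : ℕ), 0 ≤ C ∧ ∀ (x : Rd d) f,
      s.sup (schwartzSeminormFamily ℂ (Rd d) ℂ) (SchwartzMap.compSubConstCLM ℂ x f) ≤
        C * (1 + ‖x‖) ^ M * s'.sup (schwartzSeminormFamily ℂ (Rd d) ℂ) f := by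
  refine ⟨s.biUnion fun i => Finset.Iic i, 2 ^ (s.sup Prod.fst), s.sup Prod.fst, by positivity,
    fun x f => ?_⟩
  refine Seminorm.finset_sup_apply_le (by positivity) fun i hi => ?_
  refine (seminorm_compSubConstCLM_le f i.1 i.2 x).trans ?_
  have hi1 : i.1 ≤ s.sup Prod.fst := Finset.le_sup (f := Prod.fst) hi
  gcongr
  · norm_num
  · linarith [norm_nonneg x]
  · exact Seminorm.le_def.1 (Finset.sup_mono
      (Finset.subset_biUnion_of_mem (fun i => Finset.Iic i) hi)) f

theorem exists_finset_sup_modulation_le (s : Finset (ℕ × ℕ)) :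
    ∃ (s' : Finset (ℕ × ℕ)) (C : ℝ) (M : ℕ), 0 ≤ C ∧ ∀ (ξ : Rd d) f,
      s.sup (schwartzSeminormFamily ℂ (Rd d) ℂ) (modulation ξ f) ≤
        C * (1 + ‖ξ‖) ^ M * s'.sup (schwartzSeminormFamily ℂ (Rd d) ℂ) f := by
  obtain ⟨s₁, C₁, hC₁, h₁⟩ := exists_finset_seminorm_le
    (FourierTransform.fourierInvCLM ℂ 𝓢(Rd d, ℂ)) s
  obtain ⟨s₂, C₂, M, hC₂, h₂⟩ := exists_finset_sup_compSubConstCLM_le (d := d) s₁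
  obtain ⟨s₃, C₃, hC₃, h₃⟩ := exists_finset_seminorm_le
    (FourierTransform.fourierCLM ℂ 𝓢(Rd d, ℂ)) s₂
  refine ⟨s₃, C₁ * C₂ * C₃, M, by positivity, fun ξ f => ?_⟩
  rw [modulation_eq]
  refine (h₁ _).trans ?_
  have hξ : ‖(2 * Real.pi)⁻¹ • ξ‖ ≤ ‖ξ‖ := by
    rw [norm_smul]
    refine mul_le_of_le_one_left (norm_nonneg _) ?_
    rw [norm_inv, Real.norm_of_nonneg (by positivity)]
    exact inv_le_one_of_one_le₀ (by nlinarith [Real.pi_gt_three])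
  calc C₁ * s₁.sup (schwartzSeminormFamily ℂ (Rd d) ℂ)
        (SchwartzMap.compSubConstCLM ℂ ((2 * Real.pi)⁻¹ • ξ) (𝓕 f))
      ≤ C₁ * (C₂ * (1 + ‖(2 * Real.pi)⁻¹ • ξ‖) ^ M *
          s₂.sup (schwartzSeminormFamily ℂ (Rd d) ℂ) (𝓕 f)) := by gcongr; exact h₂ _ _
    _ ≤ C₁ * (C₂ * (1 + ‖ξ‖) ^ M * (C₃ * s₃.sup (schwartzSeminormFamily ℂ (Rd d) ℂ) f)) := by
        gcongr; exact h₃ _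
    _ = _ := by ring

theorem continuous_modulation (f : 𝓢(Rd d, ℂ)) : Continuous fun ξ : Rd d => modulation ξ f := by
  simp only [modulation_eq]
  have h : Continuous fun ξ : Rd d =>
      SchwartzMap.compSubConstCLM ℂ ((2 * Real.pi)⁻¹ • ξ) (𝓕 f) :=
    (continuous_compSubConstCLM (𝓕 f)).comp (continuous_const_smul _)
  exact (FourierTransform.fourierInvCLM ℂ 𝓢(Rd d, ℂ)).continuous.comp h

/-- Joint continuity needs more than continuity in each variable: the modulations satisfy seminorm
bounds that are locally uniform in `ξ`, which controls the term in which position and frequency vary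
together. -/
theorem continuous_timeFreqShift (φ : 𝓢(Rd d, ℂ)) :
    Continuous fun z : Rd d × Rd d => timeFreqShift φ z.1 z.2 := by
  rw [continuous_iff_continuousAt]
  rintro ⟨x₀, ξ₀⟩
  rw [ContinuousAt, (schwartz_withSeminorms ℂ (Rd d) ℂ).tendsto_nhds]
  intro i ε hε
  obtain ⟨s, C, M, hC, h⟩ := exists_finset_sup_modulation_le (d := d) {i}
  simp only [Finset.sup_singleton] at h
  have hc1 : Continuous fun z : Rd d × Rd d =>
      SchwartzMap.compSubConstCLM ℂ z.1 φ - SchwartzMap.compSubConstCLM ℂ x₀ φ :=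
    ((continuous_compSubConstCLM φ).comp continuous_fst).sub continuous_const
  have hc2 : Continuous fun z : Rd d × Rd d =>
      modulation z.2 (SchwartzMap.compSubConstCLM ℂ x₀ φ) -
        modulation ξ₀ (SchwartzMap.compSubConstCLM ℂ x₀ φ) :=
    ((continuous_modulation _).comp continuous_snd).sub continuous_const
  have hc : Continuous fun z : Rd d × Rd d => C * (1 + ‖z.2‖) ^ M *
      s.sup (schwartzSeminormFamily ℂ (Rd d) ℂ)
        (SchwartzMap.compSubConstCLM ℂ z.1 φ - SchwartzMap.compSubConstCLM ℂ x₀ φ) +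
      schwartzSeminormFamily ℂ (Rd d) ℂ i
        (modulation z.2 (SchwartzMap.compSubConstCLM ℂ x₀ φ) -
          modulation ξ₀ (SchwartzMap.compSubConstCLM ℂ x₀ φ)) :=
    ((continuous_const.mul ((continuous_const.add continuous_snd.norm).pow M)).mul
      ((continuous_finset_sup_seminorm s).comp hc1)).add
      (((schwartz_withSeminorms ℂ (Rd d) ℂ).continuous_seminorm i).comp hc2)
  have ht := hc.tendsto (x₀, ξ₀)
  simp only [sub_self, map_zero, mul_zero, add_zero] at ht
  filter_upwards [ht.eventually_lt_const hε] with z hz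
  refine lt_of_le_of_lt ?_ hz
  have hsplit : timeFreqShift φ z.1 z.2 - timeFreqShift φ x₀ ξ₀ =
      modulation z.2 (SchwartzMap.compSubConstCLM ℂ z.1 φ - SchwartzMap.compSubConstCLM ℂ x₀ φ) +
      (modulation z.2 (SchwartzMap.compSubConstCLM ℂ x₀ φ) -
        modulation ξ₀ (SchwartzMap.compSubConstCLM ℂ x₀ φ)) := by
    simp only [timeFreqShift, map_sub]
    abel
  rw [hsplit]
  exact (map_add_le_add _ _ _).trans (add_le_add_left (h _ _) _)

theorem exists_sup_timeFreqShift_le (φ : 𝓢(Rd d, ℂ)) (s : Finset (ℕ × ℕ)) :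
    ∃ (C : ℝ) (M : ℕ), 0 ≤ C ∧ ∀ x ξ : Rd d,
      s.sup (schwartzSeminormFamily ℂ (Rd d) ℂ) (timeFreqShift φ x ξ) ≤
        C * (1 + ‖x‖) ^ M * (1 + ‖ξ‖) ^ M := by
  obtain ⟨s₁, C₁, M₁, hC₁, h₁⟩ := exists_finset_sup_modulation_le (d := d) s
  obtain ⟨s₂, C₂, M₂, hC₂, h₂⟩ := exists_finset_sup_compSubConstCLM_le (d := d) s₁
  refine ⟨C₁ * (C₂ * s₂.sup (schwartzSeminormFamily ℂ (Rd d) ℂ) φ), max M₁ M₂, by positivity,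
    fun x ξ => ?_⟩
  calc s.sup (schwartzSeminormFamily ℂ (Rd d) ℂ) (timeFreqShift φ x ξ)
      ≤ C₁ * (1 + ‖ξ‖) ^ M₁ * (C₂ * (1 + ‖x‖) ^ M₂ *
          s₂.sup (schwartzSeminormFamily ℂ (Rd d) ℂ) φ) := by
        refine (h₁ _ _).trans ?_
        gcongr
        exact h₂ _ _
    _ ≤ C₁ * (1 + ‖ξ‖) ^ max M₁ M₂ * (C₂ * (1 + ‖x‖) ^ max M₁ M₂ *
          s₂.sup (schwartzSeminormFamily ℂ (Rd d) ℂ) φ) := by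
        gcongr <;> first | exact le_max_left _ _ | exact le_max_right _ _ | simp
    _ = _ := by ring

theorem conjS_apply (f : 𝓢(Rd d, ℂ)) (x : Rd d) : conjS f x = (starRingEnd ℂ) (f x) := rfl

theorem conjS_timeFreqShift (φ : 𝓢(Rd d, ℂ)) (x ξ : Rd d) :
    conjS (timeFreqShift φ x ξ) = timeFreqShift (conjS φ) x (-ξ) := by
  ext y
  rw [conjS_apply, timeFreqShift_apply, timeFreqShift_apply, conjS_apply, map_mul,
    ← Complex.exp_conj]
  simp

theorem stft_eq (φ : 𝓢(Rd d, ℂ)) (u : 𝓢'(Rd d, ℂ)) (x ξ : Rd d) :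
    stft φ u x ξ = (((2 * Real.pi) ^ (-(d : ℝ) / 2) : ℝ) : ℂ) *
      u (timeFreqShift (conjS φ) x (-ξ)) := by
  rw [stft, conjS_timeFreqShift]

/-- The continuous linear functional underlying a tempered distribution. -/
def toCLM (u : 𝓢'(Rd d, ℂ)) : 𝓢(Rd d, ℂ) →L[ℂ] ℂ where
  toFun := u
  map_add' := map_add u
  map_smul' := map_smul u
  cont := u.continuous

theorem toCLM_apply (u : 𝓢'(Rd d, ℂ)) (f : 𝓢(Rd d, ℂ)) : toCLM u f = u f := rfl

theorem continuous_stft (φ : 𝓢(Rd d, ℂ)) (u : 𝓢'(Rd d, ℂ)) :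
    Continuous fun z : Rd d × Rd d => stft φ u z.1 z.2 := by
  simp only [stft_eq]
  have h : Continuous ((fun z : Rd d × Rd d => timeFreqShift (conjS φ) z.1 z.2) ∘
      fun z : Rd d × Rd d => (z.1, -z.2)) :=
    (continuous_timeFreqShift (conjS φ)).comp (continuous_fst.prodMk continuous_snd.neg)
  exact continuous_const.mul ((toCLM u).continuous.comp h)

/-- The short-time Fourier transform grows at most polynomially. -/
theorem exists_norm_stft_le (φ : 𝓢(Rd d, ℂ)) (u : 𝓢'(Rd d, ℂ)) :
    ∃ (C : ℝ) (M : ℕ), 0 ≤ C ∧ ∀ x ξ : Rd d,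
      ‖stft φ u x ξ‖ ≤ C * (1 + ‖x‖) ^ M * (1 + ‖ξ‖) ^ M := by
  obtain ⟨s, C, -, hC⟩ := Seminorm.bound_of_continuous (schwartz_withSeminorms ℂ (Rd d) ℂ)
    ((normSeminorm ℂ ℂ).comp (toCLM u).toLinearMap) (continuous_norm.comp (toCLM u).continuous)
  have hu : ∀ g, ‖u g‖ ≤ C * s.sup (schwartzSeminormFamily ℂ (Rd d) ℂ) g := fun g => hC g
  obtain ⟨C', M, hC', h⟩ := exists_sup_timeFreqShift_le (conjS φ) s
  set c : ℝ := (2 * Real.pi) ^ (-(d : ℝ) / 2)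
  have hc : 0 ≤ c := by positivity
  refine ⟨c * (C * C'), M, by positivity, fun x ξ => ?_⟩
  rw [stft_eq, norm_mul, Complex.norm_real, Real.norm_of_nonneg hc]
  have h1 := hu (timeFreqShift (conjS φ) x (-ξ))
  have h2 := h x (-ξ)
  rw [norm_neg] at h2
  calc c * ‖u (timeFreqShift (conjS φ) x (-ξ))‖
      ≤ c * (C * (C' * (1 + ‖x‖) ^ M * (1 + ‖ξ‖) ^ M)) := by
        gcongr
        exact h1.trans (mul_le_mul_of_nonneg_left h2 C.2)
    _ = _ := by ring

end

section

variable {d : ℕ}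

/-! ### Taylor expansion of the phase -/

/-- The gradient of the phase function. -/
def gradPhase (p : Fin d → ℝ[X]) (v : Rd d) (t : ℝ) (ζ : Rd d) : Rd d :=
  WithLp.toLp 2 fun j => (v j)⁻¹ * ((p j).eval (ζ j - t * v j) - (p j).eval (ζ j))

/-- The Taylor coefficient of order `k` of the `j`th summand of the phase function. -/
def phaseCoeff (q : Fin d → ℝ[X]) (v : Rd d) (t : ℝ) (ζ : Rd d) (j : Fin d) (k : ℕ) : ℝ :=
  (v j)⁻¹ * ((Polynomial.hasseDeriv k (q j)).eval (ζ j - t * v j) -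
    (Polynomial.hasseDeriv k (q j)).eval (ζ j))

/-- The second order Taylor remainder of the phase function at `ζ`. -/
def phaseRem (p q : Fin d → ℝ[X]) (v : Rd d) (t : ℝ) (ζ θ : Rd d) : ℝ :=
  ∑ j, ∑ k ∈ Finset.range (order p), phaseCoeff q v t ζ j (k + 2) * θ j ^ (k + 2)

theorem natDegree_le_order (p : Fin d → ℝ[X]) (j : Fin d) : (p j).natDegree ≤ order p :=
  Finset.le_sup (f := fun j => (p j).natDegree) (Finset.mem_univ j)

theorem natDegree_le_of_derivative {p q : ℝ[X]} (h : Polynomial.derivative q = p) :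
    q.natDegree ≤ p.natDegree + 1 := by
  rw [← h, Polynomial.natDegree_derivative]
  omega

theorem eval_add_eq_sum {q : ℝ[X]} {n : ℕ} (hn : q.natDegree < n) (a b : ℝ) :
    q.eval (a + b) = ∑ k ∈ Finset.range n, (Polynomial.hasseDeriv k q).eval a * b ^ k := by
  rw [add_comm, ← Polynomial.taylor_eval, Polynomial.eval_eq_sum_range' (n := n)
    (by rwa [Polynomial.natDegree_taylor])]
  simp [Polynomial.taylor_coeff]

/-- The expansion is exact because `q j` has degree at most `m + 1`: the orders `k + 2` with `k < m`
exhaust the remainder. -/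
theorem phase_add {p q : Fin d → ℝ[X]} (hq : ∀ j, Polynomial.derivative (q j) = p j)
    (v : Rd d) (t : ℝ) (ζ θ : Rd d) :
    phase q v t (ζ + θ) =
      phase q v t ζ + inner ℝ (gradPhase p v t ζ) θ + phaseRem p q v t ζ θ := by
  have hj : ∀ j, (q j).natDegree < order p + 2 := fun j => by
    have := natDegree_le_of_derivative (hq j)
    have := natDegree_le_order p j
    omega
  simp only [phase, phaseRem, PiLp.inner_apply, gradPhase, ← Finset.sum_add_distrib]
  refine Finset.sum_congr rfl fun j _ => ?_
  rw [show (ζ + θ) j - t * v j = (ζ j - t * v j) + θ j by simp; ring,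
    show (ζ + θ) j = ζ j + θ j from rfl, eval_add_eq_sum (hj j), eval_add_eq_sum (hj j),
    ← Finset.sum_sub_distrib, Finset.sum_range_succ', Finset.sum_range_succ']
  have hs : ∑ k ∈ Finset.range (order p), phaseCoeff q v t ζ j (k + 2) * θ j ^ (k + 2) =
      (v j)⁻¹ * ∑ k ∈ Finset.range (order p),
        ((Polynomial.hasseDeriv (k + 1 + 1) (q j)).eval (ζ j - t * v j) * θ j ^ (k + 1 + 1) -
        (Polynomial.hasseDeriv (k + 1 + 1) (q j)).eval (ζ j) * θ j ^ (k + 1 + 1)) := by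
    rw [Finset.mul_sum]
    refine Finset.sum_congr rfl fun k _ => ?_
    rw [phaseCoeff]
    ring
  rw [hs]
  simp only [Polynomial.hasseDeriv_zero, zero_add, Polynomial.hasseDeriv_one, hq,
    LinearMap.id_coe, id_eq, pow_zero, mul_one, pow_one, RCLike.inner_apply, conj_trivial]
  ring

/-- A difference with bounded step lowers the growth of a polynomial by one degree. -/
theorem exists_abs_eval_sub_le (Q : ℝ[X]) {N : ℕ} (hQ : Q.natDegree ≤ N + 1) (H : ℝ) :
    ∃ C : ℝ, 0 ≤ C ∧ ∀ a h : ℝ, |h| ≤ H → |Q.eval (a - h) - Q.eval a| ≤ C * (1 + |a|) ^ N := by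
  rcases lt_or_ge H 0 with hH | hH
  · exact ⟨0, le_rfl, fun a h hh => absurd ((abs_nonneg h).trans hh) (not_le.2 hH)⟩
  refine ⟨∑ k ∈ Finset.range (N + 2), |Q.coeff k| * (H * k * (1 + H) ^ N), by positivity,
    fun a h hh => ?_⟩
  rw [Polynomial.eval_eq_sum_range' (n := N + 2) (by omega),
    Polynomial.eval_eq_sum_range' (n := N + 2) (by omega), ← Finset.sum_sub_distrib,
    Finset.sum_mul]
  refine (Finset.abs_sum_le_sum_abs _ _).trans (Finset.sum_le_sum fun k hk => ?_)
  rw [← mul_sub, abs_mul, mul_assoc]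
  refine mul_le_mul_of_nonneg_left ?_ (abs_nonneg _)
  refine (abs_pow_sub_pow_le (a - h) a k).trans ?_
  have h1 : max |a - h| |a| ≤ (1 + H) * (1 + |a|) := by
    refine max_le ?_ ?_
    · have := abs_sub a h
      nlinarith [abs_nonneg a, mul_nonneg hH (abs_nonneg a)]
    · nlinarith [abs_nonneg a, mul_nonneg hH (abs_nonneg a)]
  have h2 : (1 : ℝ) ≤ (1 + H) * (1 + |a|) := by
    nlinarith [abs_nonneg a, mul_nonneg hH (abs_nonneg a)]
  have h3 : max |a - h| |a| ^ (k - 1) ≤ ((1 + H) * (1 + |a|)) ^ N :=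
    (pow_le_pow_left₀ (le_max_of_le_left (abs_nonneg _)) h1 _).trans
      (pow_le_pow_right₀ h2 (by have := Finset.mem_range.1 hk; omega))
  have h4 : |a - h - a| ≤ H := by simpa using hh
  calc |a - h - a| * k * max |a - h| |a| ^ (k - 1)
      ≤ H * k * ((1 + H) * (1 + |a|)) ^ N := by gcongr
    _ = _ := by rw [mul_pow]; ring

/-- The Hasse derivative of order `k + 2` leaves degree at most `m - 1`, and the difference in `t v
j` removes one more. The resulting exponent `m - 2` is what makes the threshold `σ = 1 / (m - 1)`
work. -/
theorem exists_abs_phaseCoeff_le {p q : Fin d → ℝ[X]}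
    (hq : ∀ j, Polynomial.derivative (q j) = p j) (hm : 2 ≤ order p) (v : Rd d) (T : ℝ)
    (j : Fin d) (k : ℕ) :
    ∃ C : ℝ, 0 ≤ C ∧ ∀ t : ℝ, |t| ≤ T → ∀ ζ : Rd d,
      |phaseCoeff q v t ζ j (k + 2)| ≤ C * (1 + ‖ζ‖) ^ (order p - 2) := by
  obtain ⟨C, hC, h⟩ := exists_abs_eval_sub_le (Polynomial.hasseDeriv (k + 2) (q j))
    (N := order p - 2) (by
      have h1 := Polynomial.natDegree_hasseDeriv_le (q j) (k + 2)
      have h2 := natDegree_le_of_derivative (hq j)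
      have h3 := natDegree_le_order p j
      omega) (T * |v j|)
  refine ⟨|(v j)⁻¹| * C, by positivity, fun t ht ζ => ?_⟩
  rw [phaseCoeff, abs_mul, mul_assoc]
  refine mul_le_mul_of_nonneg_left ((h (ζ j) (t * v j) ?_).trans ?_) (abs_nonneg _)
  · rw [abs_mul]; gcongr
  · have : |ζ j| ≤ ‖ζ‖ := by simpa using PiLp.norm_apply_le ζ j
    gcongr

theorem hasTemperateGrowth_scaled_monomial (j : Fin d) (k : ℕ) :
    (fun θ : Rd d => (((2 * Real.pi) • θ) j) ^ k).HasTemperateGrowth :=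
  Function.HasTemperateGrowth.pow
    (((2 * Real.pi) • (EuclideanSpace.proj (𝕜 := ℝ) j : Rd d →L[ℝ] ℝ)).hasTemperateGrowth) k

theorem hasTemperateGrowth_phaseRem (p q : Fin d → ℝ[X]) (v : Rd d) (t : ℝ) (ζ : Rd d) :
    (fun θ : Rd d => phaseRem p q v t ζ ((2 * Real.pi) • θ)).HasTemperateGrowth :=
  Function.HasTemperateGrowth.sum fun j _ => Function.HasTemperateGrowth.sum fun k _ =>
    (Function.HasTemperateGrowth.const _).mul (hasTemperateGrowth_scaled_monomial j (k + 2))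

theorem exists_norm_iteratedFDeriv_phaseRem_le {p q : Fin d → ℝ[X]}
    (hq : ∀ j, Polynomial.derivative (q j) = p j) (hm : 2 ≤ order p) (v : Rd d) (T : ℝ) (n : ℕ) :
    ∃ (C : ℝ) (M : ℕ), 0 ≤ C ∧ ∀ t : ℝ, |t| ≤ T → ∀ ζ θ : Rd d, ∀ i ≤ n,
      ‖iteratedFDeriv ℝ i (fun θ : Rd d => phaseRem p q v t ζ ((2 * Real.pi) • θ)) θ‖ ≤
        C * (1 + ‖ζ‖) ^ (order p - 2) * (1 + ‖θ‖) ^ M := by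
  choose C hC h using exists_abs_phaseCoeff_le hq hm v T
  choose M B hB hM using fun (j : Fin d) (k : ℕ) =>
    (hasTemperateGrowth_scaled_monomial j (k + 2)).norm_iteratedFDeriv_le_uniform n
  let M' : ℕ := Finset.univ.sup fun j : Fin d => (Finset.range (order p)).sup (M j)
  refine ⟨∑ j, ∑ k ∈ Finset.range (order p), C j k * B j k, M',
    Finset.sum_nonneg fun j _ => Finset.sum_nonneg fun k _ => mul_nonneg (hC j k) (hB j k),
    fun t ht ζ θ i hi => ?_⟩
  have hsm : ∀ (j : Fin d) (k : ℕ), ContDiff ℝ i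
      (fun θ : Rd d => phaseCoeff q v t ζ j (k + 2) * (((2 * Real.pi) • θ) j) ^ (k + 2)) :=
    fun j k => contDiff_const.mul
      ((hasTemperateGrowth_scaled_monomial j (k + 2)).1.of_le (by exact_mod_cast le_top))
  have e : iteratedFDeriv ℝ i (fun θ : Rd d => phaseRem p q v t ζ ((2 * Real.pi) • θ)) θ =
      ∑ j, ∑ k ∈ Finset.range (order p), phaseCoeff q v t ζ j (k + 2) •
        iteratedFDeriv ℝ i (fun θ : Rd d => (((2 * Real.pi) • θ) j) ^ (k + 2)) θ := by
    simp only [phaseRem]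
    rw [iteratedFDeriv_fun_sum_apply fun j _ => (ContDiff.sum fun k _ => hsm j k).contDiffAt]
    refine Finset.sum_congr rfl fun j _ => ?_
    rw [iteratedFDeriv_fun_sum_apply fun k _ => (hsm j k).contDiffAt]
    refine Finset.sum_congr rfl fun k _ => ?_
    exact iteratedFDeriv_const_smul_apply' (a := phaseCoeff q v t ζ j (k + 2))
      ((hasTemperateGrowth_scaled_monomial j (k + 2)).1.of_le
        (by exact_mod_cast le_top)).contDiffAt
  rw [e, Finset.sum_mul, Finset.sum_mul]
  refine norm_sum_le_of_le _ fun j _ => ?_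
  rw [Finset.sum_mul, Finset.sum_mul]
  refine norm_sum_le_of_le _ fun k hk => ?_
  rw [norm_smul, Real.norm_eq_abs]
  have hMM : M j k ≤ M' := (Finset.le_sup (f := M j) hk).trans
    (Finset.le_sup (f := fun j : Fin d => (Finset.range (order p)).sup (M j)) (Finset.mem_univ j))
  have hBjk := hB j k
  have hCjk := hC j k
  calc _ ≤ (C j k * (1 + ‖ζ‖) ^ (order p - 2)) * (B j k * (1 + ‖θ‖) ^ M j k) := by
        gcongr
        · exact h j k t ht ζ
        · exact hM j k i hi θ
    _ ≤ (C j k * (1 + ‖ζ‖) ^ (order p - 2)) * (B j k * (1 + ‖θ‖) ^ M') := by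
        gcongr; simp
    _ = _ := by ring

theorem norm_iteratedFDeriv_cexp_ofReal_mul_I (n : ℕ) (s : ℝ) :
    ‖iteratedFDeriv ℝ n (fun s : ℝ => Complex.exp (s * Complex.I)) s‖ ≤ 1 := by
  have hd : ∀ n : ℕ, iteratedDeriv n (fun s : ℝ => Complex.exp (s * Complex.I)) =
      fun s : ℝ => Complex.I ^ n * Complex.exp (s * Complex.I) := by
    intro n
    induction n with
    | zero => simp
    | succ n ih =>
      rw [iteratedDeriv_succ, ih]
      funext s
      have h1 : HasDerivAt (fun s : ℝ => (s : ℂ) * Complex.I) (1 * Complex.I) s :=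
        (Complex.ofRealCLM.hasDerivAt (x := s)).mul_const Complex.I
      rw [((h1.cexp).const_mul (Complex.I ^ n)).deriv]
      ring
  rw [norm_iteratedFDeriv_eq_norm_iteratedDeriv, hd]
  simp [Complex.norm_exp_ofReal_mul_I]

/-- The oscillating factor of the kernel. -/
def oscRem (p q : Fin d → ℝ[X]) (v : Rd d) (t : ℝ) (ζ θ : Rd d) : ℂ :=
  Complex.exp ((phaseRem p q v t ζ ((2 * Real.pi) • θ) : ℝ) * Complex.I)

theorem hasTemperateGrowth_oscRem (p q : Fin d → ℝ[X]) (v : Rd d) (t : ℝ) (ζ : Rd d) :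
    (oscRem p q v t ζ).HasTemperateGrowth :=
  hasTemperateGrowth_cexp (hasTemperateGrowth_phaseRem p q v t ζ)

/-- By the chain rule for higher derivatives, each derivative of the oscillating factor costs at
most one power of `(1 + ‖ζ‖) ^ (m - 2)`, and polynomial growth in `θ`. -/
theorem exists_norm_iteratedFDeriv_oscRem_le {p q : Fin d → ℝ[X]}
    (hq : ∀ j, Polynomial.derivative (q j) = p j) (hm : 2 ≤ order p) (v : Rd d) (T : ℝ) (n : ℕ) :
    ∃ (C : ℝ) (M : ℕ), 0 ≤ C ∧ ∀ t : ℝ, |t| ≤ T → ∀ ζ θ : Rd d, ∀ i ≤ n,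
      ‖iteratedFDeriv ℝ i (oscRem p q v t ζ) θ‖ ≤
        C * ((1 + ‖ζ‖) ^ (order p - 2)) ^ n * (1 + ‖θ‖) ^ M := by
  obtain ⟨C, M, hC, h⟩ := exists_norm_iteratedFDeriv_phaseRem_le hq hm v T n
  refine ⟨n.factorial * (1 + C) ^ n, M * n, by positivity, fun t ht ζ θ i hi => ?_⟩
  set L : ℝ := (1 + ‖ζ‖) ^ (order p - 2) with hL
  have hL1 : 1 ≤ L := one_le_pow₀ (by linarith [norm_nonneg ζ])
  have hθ1 : 1 ≤ (1 + ‖θ‖) ^ M := one_le_pow₀ (by linarith [norm_nonneg θ])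
  set D : ℝ := (1 + C) * L * (1 + ‖θ‖) ^ M with hD
  have hD1 : 1 ≤ D := one_le_mul_of_one_le_of_one_le
    (one_le_mul_of_one_le_of_one_le (by linarith) hL1) hθ1
  have hcd := hasTemperateGrowth_phaseRem p q v t ζ
  have := norm_iteratedFDeriv_comp_le (𝕜 := ℝ) (n := i) (N := i) (C := 1) (D := D)
    (g := fun s : ℝ => Complex.exp (s * Complex.I))
    (f := fun θ : Rd d => phaseRem p q v t ζ ((2 * Real.pi) • θ))
    (hasTemperateGrowth_cexp_ofReal_mul_I.1.of_le (by exact_mod_cast le_top))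
    (hcd.1.of_le (by exact_mod_cast le_top)) le_rfl θ
    (fun j _ => norm_iteratedFDeriv_cexp_ofReal_mul_I j _) (fun j hj hji => by
      refine (h t ht ζ θ j (hji.trans hi)).trans ?_
      refine le_trans ?_ (le_self_pow₀ hD1 (by omega))
      rw [hD]
      gcongr
      linarith)
  refine le_trans this ?_
  calc (i.factorial : ℝ) * 1 * D ^ i ≤ n.factorial * 1 * D ^ n := by
        gcongr
    _ = _ := by rw [hD, mul_pow, mul_pow, ← pow_mul]; ring

/-! ### Decay of the kernel -/

theorem exists_pow_mul_norm_iteratedFDeriv_le {E : Type*} [NormedAddCommGroup E]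
    [NormedSpace ℝ E] (a : 𝓢(E, ℂ)) (l n : ℕ) :
    ∃ C : ℝ, 0 ≤ C ∧ ∀ i ≤ n, ∀ x, (1 + ‖x‖) ^ l * ‖iteratedFDeriv ℝ i a x‖ ≤ C :=
  ⟨2 ^ l * (Finset.Iic (l, n)).sup (schwartzSeminormFamily ℂ E ℂ) a, by positivity,
    fun _ hi x => SchwartzMap.one_add_le_sup_seminorm_apply (𝕜 := ℂ) (m := (l, n)) le_rfl hi a x⟩

/-- The Schwartz function `θ ↦ a(θ) b(θ - ω)`. -/
def mulTranslate (a b : 𝓢(Rd d, ℂ)) (ω : Rd d) : 𝓢(Rd d, ℂ) :=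
  SchwartzMap.smulLeftCLM ℂ a (SchwartzMap.compSubConstCLM ℂ ω b)

theorem mulTranslate_apply (a b : 𝓢(Rd d, ℂ)) (ω θ : Rd d) :
    mulTranslate a b ω θ = a θ * b (θ - ω) := by
  rw [mulTranslate, SchwartzMap.smulLeftCLM_apply_apply a.hasTemperateGrowth]
  simp

theorem sum_choose_mul_le {n : ℕ} {A B : ℕ → ℝ} {a b : ℝ} (hA : ∀ i ≤ n, A i ≤ a)
    (hB : ∀ i ≤ n, B i ≤ b) (hB0 : ∀ i, 0 ≤ B i) (ha : 0 ≤ a) :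
    ∑ i ∈ Finset.range (n + 1), (n.choose i : ℝ) * A i * B (n - i) ≤ 2 ^ n * (a * b) := by
  have h2 : (2 : ℝ) ^ n = ∑ i ∈ Finset.range (n + 1), (n.choose i : ℝ) := by
    exact_mod_cast (Nat.sum_range_choose n).symm
  rw [h2, Finset.sum_mul]
  refine Finset.sum_le_sum fun i hi => ?_
  have hi' : i ≤ n := Nat.lt_succ_iff.1 (Finset.mem_range.1 hi)
  rw [mul_assoc]
  exact mul_le_mul_of_nonneg_left (mul_le_mul (hA i hi') (hB _ (Nat.sub_le _ _)) (hB0 _) ha)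
    (Nat.cast_nonneg _)

/-- The two factors live near `0` and near `ω`, so their product is small when `ω` is large: `1 +
‖ω‖ ≤ (1 + ‖θ‖)(1 + ‖θ - ω‖)` splits the weight between them. -/
theorem exists_norm_iteratedFDeriv_mulTranslate_le (a b : 𝓢(Rd d, ℂ)) (l l' n : ℕ) :
    ∃ C : ℝ, 0 ≤ C ∧ ∀ i ≤ n, ∀ ω θ : Rd d,
      (1 + ‖ω‖) ^ l * (1 + ‖θ‖) ^ l' * ‖iteratedFDeriv ℝ i (mulTranslate a b ω) θ‖ ≤ C := by
  obtain ⟨C₁, hC₁, h₁⟩ := exists_pow_mul_norm_iteratedFDeriv_le a (l + l') n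
  obtain ⟨C₂, hC₂, h₂⟩ := exists_pow_mul_norm_iteratedFDeriv_le b l n
  refine ⟨2 ^ n * (C₁ * C₂), by positivity, fun i hi ω θ => ?_⟩
  have e : (mulTranslate a b ω : Rd d → ℂ) =
      fun θ => a θ * SchwartzMap.compSubConstCLM ℂ ω b θ := by
    funext θ; rw [mulTranslate_apply]; simp
  have hl := norm_iteratedFDeriv_mul_le (𝕜 := ℝ) (N := i) (a.smooth i)
    ((SchwartzMap.compSubConstCLM ℂ ω b).smooth i) θ (n := i) le_rfl
  rw [← e] at hl
  have hω : 1 + ‖ω‖ ≤ (1 + ‖θ‖) * (1 + ‖θ - ω‖) := by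
    have h : ‖ω‖ ≤ ‖θ‖ + ‖θ - ω‖ := by simpa using norm_sub_le θ (θ - ω)
    nlinarith [norm_nonneg θ, norm_nonneg (θ - ω), mul_nonneg (norm_nonneg θ) (norm_nonneg (θ - ω))]
  set A : ℕ → ℝ := fun j => (1 + ‖θ‖) ^ (l + l') * ‖iteratedFDeriv ℝ j a θ‖
  set B : ℕ → ℝ := fun j => (1 + ‖θ - ω‖) ^ l * ‖iteratedFDeriv ℝ j b (θ - ω)‖
  calc (1 + ‖ω‖) ^ l * (1 + ‖θ‖) ^ l' * ‖iteratedFDeriv ℝ i (mulTranslate a b ω) θ‖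
      ≤ ((1 + ‖θ‖) * (1 + ‖θ - ω‖)) ^ l * (1 + ‖θ‖) ^ l' *
          ∑ j ∈ Finset.range (i + 1), (i.choose j : ℝ) * ‖iteratedFDeriv ℝ j a θ‖ *
            ‖iteratedFDeriv ℝ (i - j) (SchwartzMap.compSubConstCLM ℂ ω b) θ‖ := by gcongr
    _ = ∑ j ∈ Finset.range (i + 1), (i.choose j : ℝ) * A j * B (i - j) := by
        rw [Finset.mul_sum]
        refine Finset.sum_congr rfl fun j _ => ?_
        rw [iteratedFDeriv_compSubConstCLM, mul_pow]
        simp only [A, B, pow_add]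
        ring
    _ ≤ 2 ^ i * (C₁ * C₂) := sum_choose_mul_le (fun j hj => h₁ j (hj.trans hi) θ)
        (fun j hj => h₂ j (hj.trans hi) _) (fun j => by positivity) hC₁
    _ ≤ _ := by gcongr; norm_num

/-- The amplitude `e^{i R_ζ(2πθ)} a(θ) b(θ - ω)`. -/
def amplitude (p q : Fin d → ℝ[X]) (v : Rd d) (a b : 𝓢(Rd d, ℂ)) (t : ℝ) (ζ ω : Rd d) :
    𝓢(Rd d, ℂ) :=
  SchwartzMap.smulLeftCLM ℂ (oscRem p q v t ζ) (mulTranslate a b ω)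

theorem amplitude_apply (p q : Fin d → ℝ[X]) (v : Rd d) (a b : 𝓢(Rd d, ℂ)) (t : ℝ)
    (ζ ω θ : Rd d) :
    amplitude p q v a b t ζ ω θ = oscRem p q v t ζ θ * (a θ * b (θ - ω)) := by
  rw [amplitude, SchwartzMap.smulLeftCLM_apply_apply (hasTemperateGrowth_oscRem p q v t ζ),
    mulTranslate_apply, smul_eq_mul]

theorem exists_norm_iteratedFDeriv_amplitude_le {p q : Fin d → ℝ[X]}
    (hq : ∀ j, Polynomial.derivative (q j) = p j) (hm : 2 ≤ order p) (v : Rd d)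
    (a b : 𝓢(Rd d, ℂ)) (T : ℝ) (l l' n : ℕ) :
    ∃ C : ℝ, 0 ≤ C ∧ ∀ t : ℝ, |t| ≤ T → ∀ ζ ω θ : Rd d, ∀ i ≤ n,
      (1 + ‖ω‖) ^ l * (1 + ‖θ‖) ^ l' * ‖iteratedFDeriv ℝ i (amplitude p q v a b t ζ ω) θ‖ ≤
        C * ((1 + ‖ζ‖) ^ (order p - 2)) ^ n := by
  obtain ⟨C₁, M, hC₁, h₁⟩ := exists_norm_iteratedFDeriv_oscRem_le hq hm v T n
  -- The extra `M` powers in `θ` absorb the growth of the oscillating factor.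
  obtain ⟨C₂, hC₂, h₂⟩ := exists_norm_iteratedFDeriv_mulTranslate_le a b l (l' + M) n
  refine ⟨2 ^ n * (C₁ * C₂), by positivity, fun t ht ζ ω θ i hi => ?_⟩
  set L : ℝ := ((1 + ‖ζ‖) ^ (order p - 2)) ^ n with hL
  have e : (amplitude p q v a b t ζ ω : Rd d → ℂ) =
      fun θ => oscRem p q v t ζ θ * mulTranslate a b ω θ := by
    funext θ; rw [amplitude_apply, mulTranslate_apply]
  have hl := norm_iteratedFDeriv_mul_le (𝕜 := ℝ) (N := i)
    ((hasTemperateGrowth_oscRem p q v t ζ).1.of_le (by exact_mod_cast le_top))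
    ((mulTranslate a b ω).smooth i) θ (n := i) le_rfl
  rw [← e] at hl
  set B : ℕ → ℝ := fun j => (1 + ‖ω‖) ^ l * (1 + ‖θ‖) ^ (l' + M) *
    ‖iteratedFDeriv ℝ j (mulTranslate a b ω) θ‖
  set A : ℕ → ℝ := fun j => ‖iteratedFDeriv ℝ j (oscRem p q v t ζ) θ‖ / (1 + ‖θ‖) ^ M
  have hM0 : (1 + ‖θ‖) ^ M ≠ 0 := by positivity
  calc (1 + ‖ω‖) ^ l * (1 + ‖θ‖) ^ l' * ‖iteratedFDeriv ℝ i (amplitude p q v a b t ζ ω) θ‖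
      ≤ (1 + ‖ω‖) ^ l * (1 + ‖θ‖) ^ l' *
          ∑ j ∈ Finset.range (i + 1), (i.choose j : ℝ) *
            ‖iteratedFDeriv ℝ j (oscRem p q v t ζ) θ‖ *
            ‖iteratedFDeriv ℝ (i - j) (mulTranslate a b ω) θ‖ := by gcongr
    _ = ∑ j ∈ Finset.range (i + 1), (i.choose j : ℝ) * A j * B (i - j) := by
        rw [Finset.mul_sum]
        refine Finset.sum_congr rfl fun j _ => ?_
        simp only [A, B, pow_add]
        field_simp
    _ ≤ 2 ^ i * ((C₁ * L) * C₂) := sum_choose_mul_le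
        (fun j hj => by
          rw [div_le_iff₀ (by positivity)]
          exact h₁ t ht ζ θ j (hj.trans hi))
        (fun j hj => h₂ j (hj.trans hi) ω θ) (fun j => by positivity) (by positivity)
    _ ≤ 2 ^ n * ((C₁ * L) * C₂) := by gcongr; norm_num
    _ = _ := by ring

/-- The Fourier transform of the amplitude decays rapidly, with losses controlled by powers of
`(1 + ‖ζ‖) ^ (m - 2)`. -/
theorem exists_norm_fourier_amplitude_le {p q : Fin d → ℝ[X]}
    (hq : ∀ j, Polynomial.derivative (q j) = p j) (hm : 2 ≤ order p) (v : Rd d)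
    (a b : 𝓢(Rd d, ℂ)) (T : ℝ) (k l : ℕ) :
    ∃ C : ℝ, 0 ≤ C ∧ ∀ t : ℝ, |t| ≤ T → ∀ ζ ω y : Rd d,
      (1 + ‖y‖) ^ k * (1 + ‖ω‖) ^ l * ‖𝓕 (amplitude p q v a b t ζ ω) y‖ ≤
        C * ((1 + ‖ζ‖) ^ (order p - 2)) ^ k := by
  set r : ℕ := (volume : Measure (Rd d)).integrablePower
  have hr := Measure.integrable_pow_neg_integrablePower (volume : Measure (Rd d))
  -- The weight exponent `r` makes the derivatives integrable in `θ`; the `k` derivatives give the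
  -- decay in `y` and produce the factor `L ^ k`.
  obtain ⟨C, hC, h⟩ := exists_norm_iteratedFDeriv_amplitude_le hq hm v a b T l r k
  set I : ℝ := ∫ θ : Rd d, (1 + ‖θ‖) ^ (-(r : ℝ)) with hI
  have hI0 : 0 ≤ I := integral_nonneg fun θ => by positivity
  refine ⟨2 ^ k * ((1 + 2 ^ k) * ((k + 1) * (C * I))), by positivity, fun t ht ζ ω y => ?_⟩
  set L : ℝ := (1 + ‖ζ‖) ^ (order p - 2) with hL
  set W : ℝ := (1 + ‖ω‖) ^ l with hW
  have hW0 : 0 < W := by positivity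
  set g := amplitude p q v a b t ζ ω
  have hInt : ∀ i ≤ k, W * ∫ θ, ‖iteratedFDeriv ℝ i g θ‖ ≤ C * L ^ k * I := by
    intro i hi
    rw [← integral_const_mul, hI, ← integral_const_mul]
    refine integral_mono_of_nonneg (.of_forall fun θ => by positivity) (hr.const_mul _)
      (.of_forall fun θ => ?_)
    have h1 := h t ht ζ ω θ i hi
    change W * ‖iteratedFDeriv ℝ i g θ‖ ≤ C * L ^ k * (1 + ‖θ‖) ^ (-(r : ℝ))
    rw [Real.rpow_neg (by positivity), Real.rpow_natCast, ← div_eq_mul_inv,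
      le_div_iff₀ (by positivity)]
    calc _ = W * (1 + ‖θ‖) ^ r * ‖iteratedFDeriv ℝ i g θ‖ := by ring
      _ ≤ _ := h1
  have hfour : ∀ n ≤ k, W * (‖y‖ ^ n * ‖𝓕 g y‖) ≤ 2 ^ n * ((k + 1) * (C * L ^ k * I)) := by
    intro n hn
    have h1 := Real.pow_mul_norm_iteratedFDeriv_fourier_le (f := g) (K := ⊤) (N := ⊤)
      (g.smooth ⊤) (fun k n _ _ => g.integrable_pow_mul_iteratedFDeriv volume k n)
      (k := 0) (n := n) le_top le_top y
    simp only [pow_zero, one_mul, Nat.cast_zero, mul_zero, zero_add, Finset.range_one,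
      norm_iteratedFDeriv_zero, Finset.singleton_product, Finset.sum_map,
      Function.Embedding.coeFn_mk] at h1
    rw [← SchwartzMap.fourier_coe] at h1
    calc W * (‖y‖ ^ n * ‖𝓕 g y‖)
        ≤ W * (2 ^ n * ∑ i ∈ Finset.range (n + 1), ∫ θ, ‖iteratedFDeriv ℝ i g θ‖) := by
          gcongr
      _ = 2 ^ n * ∑ i ∈ Finset.range (n + 1), W * ∫ θ, ‖iteratedFDeriv ℝ i g θ‖ := by
          rw [Finset.mul_sum, Finset.mul_sum, Finset.mul_sum]
          exact Finset.sum_congr rfl fun _ _ => by ring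
      _ ≤ 2 ^ n * ∑ i ∈ Finset.range (n + 1), C * L ^ k * I := by
          refine mul_le_mul_of_nonneg_left (Finset.sum_le_sum fun i hi => ?_) (by positivity)
          exact hInt i ((Nat.lt_succ_iff.1 (Finset.mem_range.1 hi)).trans hn)
      _ ≤ 2 ^ n * ((k + 1) * (C * L ^ k * I)) := by
          rw [Finset.sum_const, Finset.card_range, nsmul_eq_mul]
          have : ((n + 1 : ℕ) : ℝ) ≤ k + 1 := by exact_mod_cast Nat.succ_le_succ hn
          gcongr
  have hpow : (1 + ‖y‖) ^ k ≤ 2 ^ k * (1 + ‖y‖ ^ k) := by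
    refine (add_pow_le zero_le_one (norm_nonneg y) k).trans ?_
    rw [one_pow]
    gcongr
    · norm_num
    · omega
  have h0 := hfour 0 (Nat.zero_le _)
  have hk := hfour k le_rfl
  simp only [pow_zero, one_mul] at h0
  calc (1 + ‖y‖) ^ k * W * ‖𝓕 g y‖ ≤ 2 ^ k * (1 + ‖y‖ ^ k) * W * ‖𝓕 g y‖ := by gcongr
    _ = 2 ^ k * (W * ‖𝓕 g y‖ + W * (‖y‖ ^ k * ‖𝓕 g y‖)) := by ring
    _ ≤ 2 ^ k * ((k + 1) * (C * L ^ k * I) + 2 ^ k * ((k + 1) * (C * L ^ k * I))) := by gcongr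
    _ = _ := by ring

end

section

variable {d : ℕ}

/-! ### The propagator on Schwartz functions -/

/-- The symbol `e^{iφ_t(2πη)}`. -/
def symbol (q : Fin d → ℝ[X]) (v : Rd d) (t : ℝ) (η : Rd d) : ℂ :=
  Complex.exp ((phase q v t ((2 * Real.pi) • η) : ℝ) * Complex.I)

/-- The transpose of the propagator, acting on Schwartz functions. -/
def propagatorS (q : Fin d → ℝ[X]) (v : Rd d) (t : ℝ) (f : 𝓢(Rd d, ℂ)) : 𝓢(Rd d, ℂ) :=
  𝓕 (SchwartzMap.smulLeftCLM ℂ (symbol q v t) (𝓕⁻ (modulation (-(t • v)) f)))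

theorem hasTemperateGrowth_symbol' (q : Fin d → ℝ[X]) (v : Rd d) (t : ℝ) :
    (symbol q v t).HasTemperateGrowth :=
  hasTemperateGrowth_symbol q v t

theorem propagator_apply (q : Fin d → ℝ[X]) (v : Rd d) (t : ℝ) (u : 𝓢'(Rd d, ℂ))
    (f : 𝓢(Rd d, ℂ)) : propagator q v t u f = u (propagatorS q v t f) := rfl

theorem fourierInv_propagatorS_apply (q : Fin d → ℝ[X]) (v : Rd d) (t : ℝ) (f : 𝓢(Rd d, ℂ))
    (η : Rd d) :
    𝓕⁻ (propagatorS q v t f) η = symbol q v t η * 𝓕⁻ f (η - (2 * Real.pi)⁻¹ • (t • v)) := by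
  rw [propagatorS, FourierTransform.fourierInv_fourier_eq,
    SchwartzMap.smulLeftCLM_apply_apply (hasTemperateGrowth_symbol' q v t), fourierInv_modulation,
    SchwartzMap.compSubConstCLM_apply, smul_neg, neg_neg, smul_eq_mul]

theorem fourierInv_injective {f g : 𝓢(Rd d, ℂ)} (h : ∀ η, 𝓕⁻ f η = 𝓕⁻ g η) : f = g := by
  have h' : 𝓕⁻ f = 𝓕⁻ g := SchwartzMap.ext h
  have h'' := congrArg (fun k : 𝓢(Rd d, ℂ) => 𝓕 k) h'
  simpa only [FourierTransform.fourier_fourierInv_eq] using h''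

/-- The cocycle identity behind the group law of the propagator: the sum telescopes. -/
theorem phase_add_time (q : Fin d → ℝ[X]) (v : Rd d) (t s : ℝ) (ξ : Rd d) :
    phase q v t ξ + phase q v s (ξ - t • v) = phase q v (t + s) ξ := by
  simp only [phase, ← Finset.sum_add_distrib]
  refine Finset.sum_congr rfl fun j _ => ?_
  rw [show (ξ - t • v) j = ξ j - t * v j by simp,
    show ξ j - t * v j - s * v j = ξ j - (t + s) * v j by ring]
  ring

theorem propagatorS_propagatorS (q : Fin d → ℝ[X]) (v : Rd d) (t s : ℝ) (f : 𝓢(Rd d, ℂ)) :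
    propagatorS q v t (propagatorS q v s f) = propagatorS q v (t + s) f := by
  refine fourierInv_injective fun η => ?_
  simp only [fourierInv_propagatorS_apply]
  rw [← mul_assoc]
  congr 1
  · rw [symbol, symbol, symbol, ← Complex.exp_add, ← phase_add_time, smul_sub, smul_smul,
      mul_inv_cancel₀ (by positivity), one_smul]
    push_cast
    ring_nf
  · congr 1
    module

theorem propagatorS_zero (q : Fin d → ℝ[X]) (v : Rd d) (f : 𝓢(Rd d, ℂ)) :
    propagatorS q v 0 f = f := by
  refine fourierInv_injective fun η => ?_
  simp [fourierInv_propagatorS_apply, symbol, phase]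

theorem propagator_propagator (q : Fin d → ℝ[X]) (v : Rd d) (t s : ℝ) (u : 𝓢'(Rd d, ℂ)) :
    propagator q v s (propagator q v t u) = propagator q v (t + s) u := by
  ext f
  rw [propagator_apply, propagator_apply, propagator_apply, propagatorS_propagatorS]

theorem propagator_zero (q : Fin d → ℝ[X]) (v : Rd d) (u : 𝓢'(Rd d, ℂ)) :
    propagator q v 0 u = u := by
  ext f
  rw [propagator_apply, propagatorS_zero]

/-! ### The bilinear pairing with time-frequency shifts -/

/-- The bilinear pairing `h ↦ ∫ g h`. -/
def pairCLM (g : 𝓢(Rd d, ℂ)) : 𝓢(Rd d, ℂ) →L[ℂ] ℂ :=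
  (SchwartzMap.integralCLM ℂ volume).comp (SchwartzMap.smulLeftCLM ℂ g)

theorem pairCLM_apply (g h : 𝓢(Rd d, ℂ)) : pairCLM g h = ∫ s, g s * h s := by
  rw [pairCLM, ContinuousLinearMap.comp_apply, SchwartzMap.integralCLM_apply]
  simp [SchwartzMap.smulLeftCLM_apply_apply g.hasTemperateGrowth]

/-- The pairing of a propagated Schwartz function with a time-frequency shift, on the Fourier
side. -/
theorem pairCLM_propagatorS (q : Fin d → ℝ[X]) (v : Rd d) (t : ℝ) (g h : 𝓢(Rd d, ℂ)) :
    pairCLM (propagatorS q v t g) h =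
      ∫ η, symbol q v t η * 𝓕⁻ g (η - (2 * Real.pi)⁻¹ • (t • v)) * 𝓕 h η := by
  rw [pairCLM_apply]
  have h1 := SchwartzMap.integral_fourier_mul_eq (𝓕⁻ (propagatorS q v t g)) h
  rw [FourierTransform.fourier_fourierInv_eq] at h1
  rw [h1]
  simp only [fourierInv_propagatorS_apply]

theorem fourierInv_timeFreqShift_apply (χ : 𝓢(Rd d, ℂ)) (x ξ η : Rd d) :
    𝓕⁻ (timeFreqShift χ x (-ξ)) η =
      Complex.exp ((inner ℝ (η - (2 * Real.pi)⁻¹ • ξ) ((2 * Real.pi) • x) : ℝ) * Complex.I) *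
        𝓕⁻ χ (η - (2 * Real.pi)⁻¹ • ξ) := by
  rw [timeFreqShift, fourierInv_modulation, fourierInv_compSubConstCLM,
    SchwartzMap.compSubConstCLM_apply, modulation_apply, smul_neg, neg_neg]

theorem fourier_timeFreqShift_apply (φ : 𝓢(Rd d, ℂ)) (y ξ η : Rd d) :
    𝓕 (timeFreqShift φ y ξ) η =
      Complex.exp ((inner ℝ (η - (2 * Real.pi)⁻¹ • ξ) (-((2 * Real.pi) • y)) : ℝ) * Complex.I) *
        𝓕 φ (η - (2 * Real.pi)⁻¹ • ξ) := by
  rw [timeFreqShift, fourier_modulation, fourier_compSubConstCLM,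
    SchwartzMap.compSubConstCLM_apply, modulation_apply]

/-- The matrix coefficients of the propagator are Fourier transforms of amplitudes, up to
unimodular factors. -/
theorem norm_pairCLM_propagatorS {p q : Fin d → ℝ[X]}
    (hq : ∀ j, Polynomial.derivative (q j) = p j) (v : Rd d) (t : ℝ) (χ φ : 𝓢(Rd d, ℂ))
    (x ξ y η : Rd d) :
    ‖pairCLM (propagatorS q v t (timeFreqShift χ x (-ξ))) (timeFreqShift φ y ((2 * Real.pi) • η))‖ =
      ‖𝓕 (amplitude p q v (𝓕⁻ χ) (𝓕 φ) t (ξ + t • v) (η - (2 * Real.pi)⁻¹ • (ξ + t • v)))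
        (y - (x + gradPhase p v t (ξ + t • v)))‖ := by
  have hpi : (2 * Real.pi) ≠ 0 := by positivity
  set ζ := ξ + t • v with hζ
  set ω := η - (2 * Real.pi)⁻¹ • ζ with hω
  -- Centre the frequency variable at `ζ / 2π`, the point of the Taylor expansion.
  rw [pairCLM_propagatorS, ← integral_add_right_eq_self _ ((2 * Real.pi)⁻¹ • ζ), fourier_apply_eq]
  have hc : ‖Complex.exp (((phase q v t ζ + 2 * Real.pi * inner ℝ ω y : ℝ) : ℂ) * Complex.I)‖ = 1 :=
    Complex.norm_exp_ofReal_mul_I _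
  -- After insertion of the unimodular constant the integrands agree pointwise; the linear term of
  -- the phase is what shifts `y` by `gradPhase`.
  rw [← one_mul ‖∫ x, _ * amplitude _ _ _ _ _ _ _ _ x‖, ← hc, ← norm_mul, ← integral_const_mul]
  congr 1
  refine integral_congr_ae (.of_forall fun θ => ?_)
  simp only [fourierInv_timeFreqShift_apply, fourier_timeFreqShift_apply, amplitude_apply, symbol,
    oscRem]
  have e1 : θ + (2 * Real.pi)⁻¹ • ζ - (2 * Real.pi)⁻¹ • (t • v) - (2 * Real.pi)⁻¹ • ξ = θ := by
    rw [hζ]; module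
  have e2 : θ + (2 * Real.pi)⁻¹ • ζ - (2 * Real.pi)⁻¹ • ((2 * Real.pi) • η) = θ - ω := by
    rw [hω, smul_smul, inv_mul_cancel₀ hpi]; module
  have e3 : (2 * Real.pi) • (θ + (2 * Real.pi)⁻¹ • ζ) = ζ + (2 * Real.pi) • θ := by
    rw [smul_add, smul_smul, mul_inv_cancel₀ hpi]; module
  rw [e1, e2, e3, phase_add hq]
  have key : ∀ (A B C D : ℂ) (a b : ℂ), A * B * C = D →
      A * (B * a) * (C * b) = D * (a * b) := fun A B C D a b h => by rw [← h]; ring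
  rw [key _ _ _ _ _ _ rfl, ← Complex.exp_add, ← Complex.exp_add]
  rw [← mul_assoc (Complex.exp _) (Complex.exp _), ← Complex.exp_add,
    ← mul_assoc (Complex.exp _) (Complex.exp _), ← Complex.exp_add]
  congr 2
  simp only [inner_sub_left, inner_sub_right, inner_add_right, inner_smul_right, inner_neg_right]
  rw [real_inner_comm θ (gradPhase p v t ζ)]
  push_cast
  ring

/-! ### Rapid decay of the matrix coefficients -/

theorem one_add_norm_le_mul {E : Type*} [SeminormedAddCommGroup E] (x y : E) :
    1 + ‖y‖ ≤ (1 + ‖x‖) * (1 + ‖y - x‖) := by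
  have h : ‖y‖ ≤ ‖y - x‖ + ‖x‖ := by simpa using norm_add_le (y - x) x
  nlinarith [norm_nonneg x, norm_nonneg (y - x), mul_nonneg (norm_nonneg x) (norm_nonneg (y - x))]

theorem continuous_gradPhase (p : Fin d → ℝ[X]) (v ξ : Rd d) :
    Continuous fun t : ℝ => gradPhase p v t (ξ + t • v) := by
  unfold gradPhase
  refine (PiLp.continuous_toLp 2 _).comp (continuous_pi fun j => ?_)
  refine continuous_const.mul (((p j).continuous.comp ?_).sub ((p j).continuous.comp ?_))
  · have : Continuous fun t : ℝ => ξ j + t * v j - t * v j := by fun_prop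
    exact this
  · have : Continuous fun t : ℝ => ξ j + t * v j := by fun_prop
    exact this

/-- Qualitative version with `x` and `ξ` fixed, uniform for bounded times by compactness. It gives
convergence of the inversion integral and domination of the time derivative. -/
theorem exists_norm_pairCLM_propagatorS_le {p q : Fin d → ℝ[X]}
    (hq : ∀ j, Polynomial.derivative (q j) = p j) (hm : 2 ≤ order p) (v : Rd d)
    (χ φ : 𝓢(Rd d, ℂ)) (T : ℝ) (x ξ : Rd d) (N : ℕ) :
    ∃ C : ℝ, 0 ≤ C ∧ ∀ t : ℝ, |t| ≤ T → ∀ y η : Rd d,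
      (1 + ‖y‖) ^ N * (1 + ‖η‖) ^ N *
        ‖pairCLM (propagatorS q v t (timeFreqShift χ x (-ξ)))
          (timeFreqShift φ y ((2 * Real.pi) • η))‖ ≤ C := by
  obtain ⟨C, hC, h⟩ := exists_norm_fourier_amplitude_le hq hm v (𝓕⁻ χ) (𝓕 φ) T N N
  let B : ℝ → ℝ := fun t => (1 + ‖x + gradPhase p v t (ξ + t • v)‖) ^ N *
    (1 + ‖(2 * Real.pi)⁻¹ • (ξ + t • v)‖) ^ N * (C * ((1 + ‖ξ + t • v‖) ^ (order p - 2)) ^ N)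
  have hB : Continuous B := by
    have := continuous_gradPhase p v ξ
    fun_prop
  obtain ⟨K, hK⟩ := (isCompact_Icc (a := -T) (b := T)).exists_bound_of_continuousOn
    hB.continuousOn
  refine ⟨max K 0, le_max_right _ _, fun t ht y η => le_max_of_le_left ?_⟩
  refine le_trans ?_ ((Real.le_norm_self _).trans (hK t (abs_le.1 ht)))
  rw [norm_pairCLM_propagatorS hq]
  set ζ := ξ + t • v
  set X := x + gradPhase p v t ζ
  have h1 := h t ht ζ (η - (2 * Real.pi)⁻¹ • ζ) (y - X)
  set J := ‖𝓕 (amplitude p q v (𝓕⁻ χ) (𝓕 φ) t ζ (η - (2 * Real.pi)⁻¹ • ζ)) (y - X)‖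
  calc (1 + ‖y‖) ^ N * (1 + ‖η‖) ^ N * J
      ≤ ((1 + ‖X‖) * (1 + ‖y - X‖)) ^ N *
          ((1 + ‖(2 * Real.pi)⁻¹ • ζ‖) * (1 + ‖η - (2 * Real.pi)⁻¹ • ζ‖)) ^ N * J := by
        gcongr <;> exact one_add_norm_le_mul _ _
    _ = (1 + ‖X‖) ^ N * (1 + ‖(2 * Real.pi)⁻¹ • ζ‖) ^ N *
          ((1 + ‖y - X‖) ^ N * (1 + ‖η - (2 * Real.pi)⁻¹ • ζ‖) ^ N * J) := by
        rw [mul_pow, mul_pow]; ring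
    _ ≤ B t := by
        simp only [B]
        gcongr

/-! ### The inversion formula for the short-time Fourier transform -/

/-- The squared `L²` norm of a window. -/
def windowMass (φ : 𝓢(Rd d, ℂ)) : ℝ := ∫ y, ‖φ y‖ ^ 2

theorem windowMass_pos {φ : 𝓢(Rd d, ℂ)} (hφ : φ ≠ 0) : 0 < windowMass φ := by
  have hx : ∃ x, φ x ≠ 0 := by
    by_contra! h
    exact hφ (SchwartzMap.ext h)
  obtain ⟨x, hx⟩ := hx
  have hc : Continuous fun y => ‖φ y‖ ^ 2 := φ.continuous.norm.pow 2
  have hi : Integrable (fun y => ‖φ y‖ ^ 2) := (φ.memLp 2 volume).integrable_norm_pow (by norm_num)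
  refine (integral_pos_iff_support_of_nonneg (fun y => by positivity) hi).2 ?_
  refine IsOpen.measure_pos _ hc.isOpen_support ⟨x, ?_⟩
  simpa using hx

/-- Iterated form of the inversion formula. -/
theorem integral_integral_inversion (φ g : 𝓢(Rd d, ℂ)) (s : Rd d) :
    ∫ y, ∫ η, pairCLM g (timeFreqShift φ y ((2 * Real.pi) • η)) *
        timeFreqShift (conjS φ) y (-((2 * Real.pi) • η)) s = g s * windowMass φ := by
  have inner_eq : ∀ y, ∫ η, pairCLM g (timeFreqShift φ y ((2 * Real.pi) • η)) *
        timeFreqShift (conjS φ) y (-((2 * Real.pi) • η)) s = g s * (‖φ (s - y)‖ ^ 2 : ℝ) := by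
    intro y
    have hG : ∀ η, pairCLM g (timeFreqShift φ y ((2 * Real.pi) • η)) =
        𝓕⁻ (mulTranslate g φ y) η := by
      intro η
      rw [pairCLM_apply, fourierInv_apply_eq]
      refine integral_congr_ae (.of_forall fun x => ?_)
      simp only [timeFreqShift_apply, mulTranslate_apply]
      rw [inner_smul_right]
      ring
    -- For fixed `y` the frequency integral is Fourier inversion of `g φ(· - y)` at `s`; the
    -- position integral then yields the mass of the window.
    have h1 := fourier_apply_eq (𝓕⁻ (mulTranslate g φ y)) s
    rw [FourierTransform.fourier_fourierInv_eq, mulTranslate_apply] at h1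
    have h2 : ∀ η, pairCLM g (timeFreqShift φ y ((2 * Real.pi) • η)) *
        timeFreqShift (conjS φ) y (-((2 * Real.pi) • η)) s =
        (Complex.exp ((-2 * Real.pi * inner ℝ η s : ℝ) * Complex.I) *
          𝓕⁻ (mulTranslate g φ y) η) * (starRingEnd ℂ) (φ (s - y)) := by
      intro η
      rw [hG, timeFreqShift_apply, conjS_apply, inner_neg_right, inner_smul_right,
        real_inner_comm η s, neg_mul, neg_mul]
      ring
    simp only [h2]
    rw [integral_mul_const, ← h1, mul_assoc, Complex.mul_conj, Complex.normSq_eq_norm_sq]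
  simp only [inner_eq]
  rw [integral_const_mul, integral_complex_ofReal,
    integral_sub_left_eq_self (fun y => ‖φ y‖ ^ 2) volume s, windowMass]

theorem integrable_prod_weight (d : ℕ) :
    Integrable fun z : Rd d × Rd d =>
      (1 + ‖z.1‖) ^ (-((volume : Measure (Rd d)).integrablePower : ℝ)) *
        (1 + ‖z.2‖) ^ (-((volume : Measure (Rd d)).integrablePower : ℝ)) :=
  (Measure.integrable_pow_neg_integrablePower (volume : Measure (Rd d))).mul_prod
    (Measure.integrable_pow_neg_integrablePower (volume : Measure (Rd d)))

theorem continuous_timeFreqShift_comp (φ : 𝓢(Rd d, ℂ)) (c : ℝ) :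
    Continuous fun z : Rd d × Rd d => timeFreqShift φ z.1 (c • z.2) := by
  have h : Continuous ((fun z : Rd d × Rd d => timeFreqShift φ z.1 z.2) ∘
      fun z : Rd d × Rd d => (z.1, c • z.2)) :=
    (continuous_timeFreqShift φ).comp (continuous_fst.prodMk (continuous_snd.const_smul c))
  exact h

/-- A function on phase space that decays faster than any power. -/
def RapidDecay (f : Rd d × Rd d → ℂ) : Prop :=
  ∀ N : ℕ, ∃ C : ℝ, 0 ≤ C ∧ ∀ z : Rd d × Rd d, (1 + ‖z.1‖) ^ N * (1 + ‖z.2‖) ^ N * ‖f z‖ ≤ C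

theorem rpow_weight_mul_ge {a c C : ℝ} {r : ℕ} (ha : 0 < a) (hc : 0 < c) {w : ℝ}
    (h : a ^ r * c ^ r * w ≤ C) : w ≤ C * (a ^ (-(r : ℝ)) * c ^ (-(r : ℝ))) := by
  rw [Real.rpow_neg ha.le, Real.rpow_neg hc.le, Real.rpow_natCast, Real.rpow_natCast,
    ← mul_inv, ← div_eq_mul_inv, le_div_iff₀ (by positivity)]
  linarith

/-- The inversion formula for the short-time Fourier transform of a tempered distribution. -/
theorem apply_eq_integral_pairCLM (φ g : 𝓢(Rd d, ℂ))
    (hg : RapidDecay fun z => pairCLM g (timeFreqShift φ z.1 ((2 * Real.pi) • z.2)))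
    (u : 𝓢'(Rd d, ℂ)) :
    u g * windowMass φ = ∫ z : Rd d × Rd d,
      pairCLM g (timeFreqShift φ z.1 ((2 * Real.pi) • z.2)) *
        u (timeFreqShift (conjS φ) z.1 (-((2 * Real.pi) • z.2))) := by
  set W : Rd d × Rd d → ℂ := fun z => pairCLM g (timeFreqShift φ z.1 ((2 * Real.pi) • z.2)) with hW
  have hWc : Continuous W := (pairCLM g).continuous.comp (continuous_timeFreqShift_comp φ _)
  let F : Rd d × Rd d → 𝓢(Rd d, ℂ) := fun z =>
    W z • timeFreqShift (conjS φ) z.1 ((-(2 * Real.pi)) • z.2)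
  have hFc : Continuous F := hWc.smul (continuous_timeFreqShift_comp (conjS φ) _)
  have hInt : ∀ k n, Integrable (fun z => SchwartzMap.seminorm ℂ k n (F z)) := by
    intro k n
    obtain ⟨C₁, M, hC₁, h₁⟩ := exists_sup_timeFreqShift_le (conjS φ) {(k, n)}
    simp only [Finset.sup_singleton] at h₁
    set r := (volume : Measure (Rd d)).integrablePower with hr
    -- `M` powers beat the growth of the seminorms of the time-frequency shifts, `r` powers give
    -- integrability.
    obtain ⟨C₂, hC₂, h₂⟩ := hg (M + r)
    refine ((integrable_prod_weight d).const_mul ((C₁ * (2 * Real.pi + 1) ^ M) * C₂)).mono'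
      (((schwartz_withSeminorms ℂ (Rd d) ℂ).continuous_seminorm (k, n)).comp hFc
        ).aestronglyMeasurable (.of_forall fun z => ?_)
    rw [Real.norm_of_nonneg (apply_nonneg _ _)]
    refine rpow_weight_mul_ge (by positivity) (by positivity) ?_
    have h3 : SchwartzMap.seminorm ℂ k n (F z) ≤
        ‖W z‖ * (C₁ * (1 + ‖z.1‖) ^ M * (1 + ‖(-(2 * Real.pi)) • z.2‖) ^ M) := by
      rw [map_smul_eq_mul]
      exact mul_le_mul_of_nonneg_left (h₁ _ _) (norm_nonneg _)
    have h4 : 1 + ‖(-(2 * Real.pi)) • z.2‖ ≤ (2 * Real.pi + 1) * (1 + ‖z.2‖) := by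
      rw [norm_smul, norm_neg, Real.norm_of_nonneg (by positivity)]
      nlinarith [norm_nonneg z.2, Real.pi_pos]
    calc _ ≤ (1 + ‖z.1‖) ^ r * (1 + ‖z.2‖) ^ r * (‖W z‖ * (C₁ * (1 + ‖z.1‖) ^ M *
            ((2 * Real.pi + 1) * (1 + ‖z.2‖)) ^ M)) := by
          gcongr
          exact h3.trans (by gcongr)
      _ = (C₁ * (2 * Real.pi + 1) ^ M) *
            ((1 + ‖z.1‖) ^ (M + r) * (1 + ‖z.2‖) ^ (M + r) * ‖W z‖) := by
          rw [mul_pow, pow_add, pow_add]; ring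
      _ ≤ _ := by gcongr; exact h₂ z
  have hF : ∀ z, F z = W z • timeFreqShift (conjS φ) z.1 (-((2 * Real.pi) • z.2)) := fun z => by
    simp only [F, neg_smul]
  have hpt : ∀ s, ((windowMass φ : ℂ) • g) s = ∫ z, F z s := by
    intro s
    have hi := integrable_iteratedFDeriv hFc hInt 0 s
    have hi' : Integrable fun z : Rd d × Rd d => F z s := by
      refine (((continuousMultilinearCurryFin0 ℝ (Rd d) ℂ
        ).toContinuousLinearEquiv.toContinuousLinearMap).integrable_comp hi).congr
        (.of_forall fun z => ?_)
      simp
    have h5 := integral_integral_inversion φ g s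
    rw [show ((windowMass φ : ℂ) • g) s = g s * windowMass φ by simp [mul_comm], ← h5]
    rw [show (volume : Measure (Rd d × Rd d)) = volume.prod volume from rfl] at hi' ⊢
    rw [integral_prod _ hi']
    refine integral_congr_ae (.of_forall fun y => integral_congr_ae (.of_forall fun η => ?_))
    simp only [hF, hW]
    simp
  have h6 := apply_integral_eq hFc hInt hpt (toCLM u)
  simp only [hF, map_smul, smul_eq_mul, toCLM_apply] at h6
  rw [mul_comm, h6]

/-- The short-time Fourier transform of a propagated distribution in terms of the original one. -/
theorem apply_propagatorS_eq_integral {p q : Fin d → ℝ[X]}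
    (hq : ∀ j, Polynomial.derivative (q j) = p j) (hm : 2 ≤ order p) (v : Rd d) (t : ℝ)
    (χ φ : 𝓢(Rd d, ℂ)) (x ξ : Rd d) (u : 𝓢'(Rd d, ℂ)) :
    u (propagatorS q v t (timeFreqShift χ x (-ξ))) * windowMass φ = ∫ z : Rd d × Rd d,
      pairCLM (propagatorS q v t (timeFreqShift χ x (-ξ)))
          (timeFreqShift φ z.1 ((2 * Real.pi) • z.2)) *
        u (timeFreqShift (conjS φ) z.1 (-((2 * Real.pi) • z.2))) := by
  refine apply_eq_integral_pairCLM φ _ (fun N => ?_) u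
  obtain ⟨C, hC, h⟩ := exists_norm_pairCLM_propagatorS_le hq hm v χ φ |t| x ξ N
  exact ⟨C, hC, fun z => h t le_rfl z.1 z.2⟩

end

section

variable {d : ℕ}

/-! ### Propagation estimates -/

/-- The integrable weight `(1 + ‖x‖)^{-r}`. -/
def weight (x : Rd d) : ℝ := (1 + ‖x‖) ^ (-((volume : Measure (Rd d)).integrablePower : ℝ))

theorem weight_eq (x : Rd d) :
    weight x = ((1 + ‖x‖) ^ (volume : Measure (Rd d)).integrablePower)⁻¹ := by
  rw [weight, Real.rpow_neg (by positivity), Real.rpow_natCast]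

theorem stft_propagator_mul (p q : Fin d → ℝ[X])
    (hq : ∀ j, Polynomial.derivative (q j) = p j) (hm : 2 ≤ order p) (v : Rd d) (t : ℝ)
    (φ ψ : 𝓢(Rd d, ℂ)) (u : 𝓢'(Rd d, ℂ)) (x ξ : Rd d) :
    stft ψ (propagator q v t u) x ξ * windowMass φ = ∫ z : Rd d × Rd d,
      pairCLM (propagatorS q v t (timeFreqShift (conjS ψ) x (-ξ)))
          (timeFreqShift φ z.1 ((2 * Real.pi) • z.2)) *
        stft φ u z.1 ((2 * Real.pi) • z.2) := by
  rw [stft_eq, propagator_apply, mul_assoc, apply_propagatorS_eq_integral hq hm,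
    ← integral_const_mul]
  refine integral_congr_ae (.of_forall fun z => ?_)
  simp only [stft_eq]
  ring

/-- Recentring phase space at `(X, ζ / 2π)` reduces a bound on the propagated transform to a
pointwise bound of kernel times `V u` by an integrable weight. -/
theorem norm_stft_propagator_le {p q : Fin d → ℝ[X]}
    (hq : ∀ j, Polynomial.derivative (q j) = p j) (hm : 2 ≤ order p) (v : Rd d) (t : ℝ)
    (φ ψ : 𝓢(Rd d, ℂ)) (u : 𝓢'(Rd d, ℂ)) (x ξ : Rd d) {X ζ : Rd d}
    (hζ : ζ = ξ + t • v) (hX : X = x + gradPhase p v t ζ) (B : ℝ)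
    (hB : ∀ y ω : Rd d, ‖𝓕 (amplitude p q v (𝓕⁻ (conjS ψ)) (𝓕 φ) t ζ ω) y‖ *
      ‖stft φ u (y + X) ((2 * Real.pi) • ω + ζ)‖ ≤ B * (weight y * weight ω)) :
    ‖stft ψ (propagator q v t u) x ξ‖ * windowMass φ ≤
      B * ∫ z : Rd d × Rd d, weight z.1 * weight z.2 := by
  have h0 : 0 ≤ windowMass φ := integral_nonneg fun _ => by positivity
  have hpi : (2 * Real.pi) ≠ 0 := by positivity
  have h1 : ‖stft ψ (propagator q v t u) x ξ‖ * windowMass φ =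
      ‖stft ψ (propagator q v t u) x ξ * windowMass φ‖ := by
    rw [norm_mul, Complex.norm_real, Real.norm_of_nonneg h0]
  have : (volume : Measure (Rd d × Rd d)).IsAddRightInvariant :=
    inferInstanceAs (((volume : Measure (Rd d)).prod (volume : Measure (Rd d))).IsAddRightInvariant)
  have hw := integral_sub_right_eq_self (μ := (volume : Measure (Rd d × Rd d)))
    (fun z : Rd d × Rd d => weight z.1 * weight z.2) (X, (2 * Real.pi)⁻¹ • ζ)
  have hwi : Integrable fun z : Rd d × Rd d => weight z.1 * weight z.2 := integrable_prod_weight d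
  rw [h1, stft_propagator_mul p q hq hm, ← hw, ← integral_const_mul]
  refine norm_integral_le_of_norm_le
    ((hwi.comp_sub_right (X, (2 * Real.pi)⁻¹ • ζ)).const_mul B) (.of_forall fun z => ?_)
  rw [norm_mul, norm_pairCLM_propagatorS hq, ← hζ, ← hX]
  have h2 := hB (z.1 - X) (z.2 - (2 * Real.pi)⁻¹ • ζ)
  rw [sub_add_cancel, smul_sub, smul_smul, mul_inv_cancel₀ hpi, one_smul, sub_add_cancel] at h2
  exact h2

/-- Far away in position, `k` extra powers of decay gain `(L / a) ^ k ≲ s ^ (-k)`, since `L s ≲ lam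
≲ a`. This pays for `lam ^ E` and for the loss `L ^ K ≲ lam ^ K`. -/
theorem mul_le_of_far_position {lam s L a w J c δ C : ℝ} {E K k : ℕ} (hlam : 1 ≤ lam)
    (hs : 1 ≤ s) (hL : 0 ≤ L) (ha : 1 ≤ a) (hw : 0 ≤ w) (hJ : 0 ≤ J) (hc : 0 ≤ c) (hδ : 0 < δ)
    (hC : 0 ≤ C) (hLs : L * s ≤ c * lam) (hsk : lam ^ (E + K) ≤ s ^ k) (hfar : δ * lam ≤ a)
    (hJb : a ^ (K + k) * w ^ K * J ≤ C * L ^ (K + k)) :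
    lam ^ E * (a ^ K * w ^ K * J) ≤ C * (c ^ K * (c / δ) ^ k) := by
  have ha0 : 0 < a := by linarith
  have hl0 : 0 < lam := by linarith
  have hL1 : L ≤ c * lam := (le_mul_of_one_le_right hL hs).trans hLs
  have hL2 : L * s ≤ c / δ * a := by
    refine hLs.trans ?_
    rw [div_mul_eq_mul_div, le_div_iff₀ hδ]
    nlinarith
  refine le_of_mul_le_mul_right ?_ (show 0 < a ^ k * lam ^ K by positivity)
  calc lam ^ E * (a ^ K * w ^ K * J) * (a ^ k * lam ^ K)
      = lam ^ (E + K) * (a ^ (K + k) * w ^ K * J) := by rw [pow_add, pow_add]; ring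
    _ ≤ s ^ k * (C * L ^ (K + k)) := by gcongr
    _ = C * (L ^ K * (L * s) ^ k) := by rw [pow_add, mul_pow]; ring
    _ ≤ C * ((c * lam) ^ K * (c / δ * a) ^ k) := by gcongr
    _ = _ := by rw [mul_pow, mul_pow]; ring

/-- Far away in frequency the extra decay costs no power of `L`, so `w ≳ s` alone yields the gain `s
^ (-k)`. -/
theorem mul_le_of_far_frequency {lam s L a w J c δ C : ℝ} {E K k : ℕ} (hlam : 1 ≤ lam)
    (hs : 1 ≤ s) (hL : 0 ≤ L) (ha : 0 ≤ a) (hw : 1 ≤ w) (hJ : 0 ≤ J) (hδ : 0 < δ)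
    (hC : 0 ≤ C) (hLs : L * s ≤ c * lam) (hsk : lam ^ (E + K) ≤ s ^ k) (hfar : δ * s ≤ w)
    (hJb : a ^ K * w ^ (K + k) * J ≤ C * L ^ K) :
    lam ^ E * (a ^ K * w ^ K * J) ≤ C * (c ^ K * (1 / δ) ^ k) := by
  have hw0 : 0 < w := by linarith
  have hl0 : 0 < lam := by linarith
  have hL1 : L ≤ c * lam := (le_mul_of_one_le_right hL hs).trans hLs
  have hs2 : s ≤ 1 / δ * w := by
    rw [div_mul_eq_mul_div, le_div_iff₀ hδ]
    linarith
  refine le_of_mul_le_mul_right ?_ (show 0 < w ^ k * lam ^ K by positivity)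
  calc lam ^ E * (a ^ K * w ^ K * J) * (w ^ k * lam ^ K)
      = lam ^ (E + K) * (a ^ K * w ^ (K + k) * J) := by rw [pow_add, pow_add]; ring
    _ ≤ s ^ k * (C * L ^ K) := by gcongr
    _ ≤ (1 / δ * w) ^ k * (C * (c * lam) ^ K) := by gcongr
    _ = _ := by rw [mul_pow, mul_pow]; ring

theorem not_mem_gaborWF_iff {σ : ℝ} {φ : 𝓢(Rd d, ℂ)} {u : 𝓢'(Rd d, ℂ)} {z₀ : Rd d × Rd d}
    (hz : z₀ ≠ 0) : z₀ ∉ gaborWF σ φ u ↔ ∃ U : Set (Rd d × Rd d), IsOpen U ∧ z₀ ∈ U ∧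
    ∀ N : ℕ, ∃ C : ℝ, ∀ z ∈ U, ∀ r : ℝ, 0 < r →
      r ^ N * ‖stft φ u (r • z.1) (r ^ σ • z.2)‖ ≤ C := by
  simp only [gaborWF, Set.mem_ofPred_eq, not_and, not_not]
  exact ⟨fun h => h hz, fun h _ => h⟩

set_option maxHeartbeats 1000000 in
/-- Uniform decay of the short-time Fourier transform of the propagated distribution at points
whose flow-out stays in a conic region where the original one decays. -/
theorem exists_pow_mul_norm_stft_propagator_le {p q : Fin d → ℝ[X]}
    (hq : ∀ j, Polynomial.derivative (q j) = p j) (hm : 2 ≤ order p) (v : Rd d) (t : ℝ)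
    {φ : 𝓢(Rd d, ℂ)} (hφ : φ ≠ 0) (ψ : 𝓢(Rd d, ℂ)) (u : 𝓢'(Rd d, ℂ)) {σ : ℝ} (hσ : 0 < σ)
    (hσm : σ * ((order p : ℝ) - 1) ≤ 1) {w₀ : Rd d × Rd d} {δ : ℝ} (hδ : 0 < δ)
    (hU : ∀ N : ℕ, ∃ C : ℝ, ∀ z ∈ Metric.ball w₀ (2 * δ), ∀ r : ℝ, 0 < r →
      r ^ N * ‖stft φ u (r • z.1) (r ^ σ • z.2)‖ ≤ C) (N : ℕ) :
    ∃ C : ℝ, ∀ (x ξ : Rd d) (r : ℝ), 1 ≤ r → ∀ w ∈ Metric.ball w₀ δ,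
      r • w.1 = x + gradPhase p v t (ξ + t • v) → r ^ σ • w.2 = ξ + t • v →
      r ^ N * ‖stft ψ (propagator q v t u) x ξ‖ ≤ C := by
  obtain ⟨Cu, M, hCu, hu⟩ := exists_norm_stft_le φ u
  set ρ := (volume : Measure (Rd d)).integrablePower with hρ
  -- The `ρ` additional powers compensate `L ^ ρ ≲ r ^ ρ`, the price of integrable kernel decay near
  -- the centre.
  obtain ⟨CN, hCN⟩ := hU (N + ρ)
  have hCN' : ∀ z ∈ Metric.ball w₀ (2 * δ), ∀ r : ℝ, 0 < r →
      r ^ (N + ρ) * ‖stft φ u (r • z.1) (r ^ σ • z.2)‖ ≤ |CN| :=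
    fun z hz r hr => (hCN z hz r hr).trans (le_abs_self _)
  -- Away from the centre only polynomial growth of `V u` is known: it costs `M` powers of each
  -- weight and `r ^ (2 * M)`, which enter `K` and `E`.
  set K := ρ + M with hK
  set E := N + 2 * M with hE
  obtain ⟨k, hk⟩ := exists_nat_ge (((E + K : ℕ) : ℝ) / σ)
  have hk' : ((E + K : ℕ) : ℝ) ≤ σ * k := by
    rw [div_le_iff₀ hσ] at hk; linarith
  set a₀ := 𝓕⁻ (conjS ψ)
  set b₀ := 𝓕 φ
  obtain ⟨C₀, hC₀, h₀⟩ := exists_norm_fourier_amplitude_le hq hm v a₀ b₀ |t| ρ ρ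
  obtain ⟨C₁, hC₁, h₁⟩ := exists_norm_fourier_amplitude_le hq hm v a₀ b₀ |t| (K + k) K
  obtain ⟨C₂, hC₂, h₂⟩ := exists_norm_fourier_amplitude_le hq hm v a₀ b₀ |t| K (K + k)
  set A : ℝ := 1 + (‖w₀‖ + δ) with hA
  have hA1 : 1 ≤ A := by rw [hA]; linarith [norm_nonneg w₀]
  set c : ℝ := A ^ (order p - 2) with hc
  have hc0 : 0 ≤ c := by positivity
  set D₀ : ℝ := C₀ * c ^ ρ * |CN| with hD₀
  set G : ℝ := Cu * (A ^ M * (7 * A) ^ M) with hG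
  set D₁ : ℝ := G * (C₁ * (c ^ K * (c / δ) ^ k)) with hD₁
  set D₂ : ℝ := G * (C₂ * (c ^ K * (1 / (δ / 7)) ^ k)) with hD₂
  have hD₀0 : 0 ≤ D₀ := by positivity
  have hD₁0 : 0 ≤ D₁ := by positivity
  have hD₂0 : 0 ≤ D₂ := by positivity
  set I : ℝ := ∫ z : Rd d × Rd d, weight z.1 * weight z.2 with hI
  refine ⟨(D₀ + D₁ + D₂) * I / windowMass φ, fun x ξ r hr w hw hX hζ => ?_⟩
  have hr0 : 0 < r := by linarith
  set s : ℝ := r ^ σ with hs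
  have hs1 : 1 ≤ s := Real.one_le_rpow hr hσ.le
  have hs0 : 0 < s := by linarith
  -- The hypothesis `σ (m - 1) ≤ 1` enters here; it gives `L s ≤ c r` below.
  have hsm : s ^ (order p - 1) ≤ r := by
    rw [hs, ← Real.rpow_natCast, ← Real.rpow_mul hr0.le, Nat.cast_sub (by omega), Nat.cast_one]
    exact (Real.rpow_le_rpow_of_exponent_le hr hσm).trans_eq (Real.rpow_one r)
  have hsr : s ≤ r := (le_self_pow₀ hs1 (by omega)).trans hsm
  have hsk : r ^ (E + K) ≤ s ^ k := by
    rw [hs, ← Real.rpow_natCast (r ^ σ), ← Real.rpow_mul hr0.le, ← Real.rpow_natCast r]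
    exact Real.rpow_le_rpow_of_exponent_le hr hk'
  have hw' : ‖w‖ ≤ ‖w₀‖ + δ := by
    have h1 : ‖w - w₀‖ < δ := by rwa [← dist_eq_norm]
    have h2 : ‖w‖ ≤ ‖w - w₀‖ + ‖w₀‖ := by simpa using norm_add_le (w - w₀) w₀
    linarith
  have hw1 : ‖w.1‖ ≤ ‖w₀‖ + δ := (norm_fst_le w).trans hw'
  have hw2 : ‖w.2‖ ≤ ‖w₀‖ + δ := (norm_snd_le w).trans hw'
  set ζ := s • w.2 with hζdef
  set X := r • w.1 with hXdef
  have hX1 : 1 + ‖X‖ ≤ A * r := by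
    rw [hXdef, norm_smul, Real.norm_of_nonneg hr0.le, hA]
    nlinarith [norm_nonneg w.1]
  have hζ1 : 1 + ‖ζ‖ ≤ A * s := by
    rw [hζdef, norm_smul, Real.norm_of_nonneg hs0.le, hA]
    nlinarith [norm_nonneg w.2]
  set L : ℝ := (1 + ‖ζ‖) ^ (order p - 2) with hL
  have hL0 : 0 ≤ L := by positivity
  have hLs : L * s ≤ c * r := by
    calc L * s ≤ (A * s) ^ (order p - 2) * s :=
          mul_le_mul_of_nonneg_right (pow_le_pow_left₀ (by positivity) hζ1 _) hs0.le
      _ = c * s ^ (order p - 2 + 1) := by rw [mul_pow, pow_succ]; ring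
      _ ≤ c * r := by
          rw [show order p - 2 + 1 = order p - 1 by omega]
          gcongr
  have hLr : L ≤ c * r := (le_mul_of_one_le_right hL0 hs1).trans hLs
  have hmain := norm_stft_propagator_le hq hm v t φ ψ u x ξ (X := X) (ζ := ζ) hζ
    (by rw [hX, hζ]) ((D₀ + D₁ + D₂) / r ^ N) (fun y ω => ?_)
  · rw [le_div_iff₀ (windowMass_pos hφ)]
    calc r ^ N * ‖stft ψ (propagator q v t u) x ξ‖ * windowMass φ
        ≤ r ^ N * ((D₀ + D₁ + D₂) / r ^ N * I) := by
          rw [mul_assoc]; gcongr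
      _ = _ := by field_simp
  · set J := ‖𝓕 (amplitude p q v a₀ b₀ t ζ ω) y‖ with hJ
    set V := ‖stft φ u (y + X) ((2 * Real.pi) • ω + ζ)‖ with hV
    have hJ0 : 0 ≤ J := norm_nonneg _
    have hV0 : 0 ≤ V := norm_nonneg _
    set a := 1 + ‖y‖ with ha
    set b := 1 + ‖ω‖ with hb
    have ha1 : 1 ≤ a := by rw [ha]; linarith [norm_nonneg y]
    have hb1 : 1 ≤ b := by rw [hb]; linarith [norm_nonneg ω]
    rw [weight_eq, weight_eq, ← mul_inv, ← hρ, div_mul_eq_mul_div, ← div_eq_mul_inv,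
      div_div, le_div_iff₀ (by positivity)]
    suffices h : r ^ N * (a ^ ρ * b ^ ρ * J * V) ≤ D₀ + D₁ + D₂ by
      calc J * V * (a ^ ρ * b ^ ρ * r ^ N) = r ^ N * (a ^ ρ * b ^ ρ * J * V) := by ring
        _ ≤ _ := h
    -- Near the centre the rescaled point stays in the ball where `V u` decays; elsewhere the kernel
    -- supplies the decay.
    by_cases hnear : ‖y‖ < δ * r ∧ ‖(2 * Real.pi) • ω‖ < δ * s
    · set z : Rd d × Rd d := (w.1 + r⁻¹ • y, w.2 + s⁻¹ • ((2 * Real.pi) • ω)) with hz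
      have hzb : z ∈ Metric.ball w₀ (2 * δ) := by
        have h1 : dist z w < δ := by
          rw [dist_eq_norm, Prod.norm_def]
          refine max_lt ?_ ?_
          · simp only [hz, Prod.fst_sub, add_sub_cancel_left]
            rw [norm_smul, norm_inv, Real.norm_of_nonneg hr0.le, inv_mul_lt_iff₀ hr0]
            linarith [hnear.1]
          · simp only [hz, Prod.snd_sub, add_sub_cancel_left]
            rw [norm_smul, norm_inv, Real.norm_of_nonneg hs0.le, inv_mul_lt_iff₀ hs0]
            linarith [hnear.2]
        have h2 := dist_triangle z w w₀
        have h3 : dist w w₀ < δ := hw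
        rw [Metric.mem_ball]
        linarith
      have h4 := hCN' z hzb r hr0
      have e1 : r • z.1 = y + X := by
        simp only [hz, hXdef]
        rw [smul_add, smul_smul, mul_inv_cancel₀ hr0.ne', one_smul, add_comm]
      have e2 : r ^ σ • z.2 = (2 * Real.pi) • ω + ζ := by
        rw [← hs]
        simp only [hz, hζdef]
        rw [smul_add, smul_smul s s⁻¹, mul_inv_cancel₀ hs0.ne', one_smul, add_comm]
      rw [e1, e2, ← hV] at h4
      have h5 := h₀ t le_rfl ζ ω y
      rw [← hJ, ← ha, ← hb, ← hL] at h5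
      have h6 : r ^ N * (a ^ ρ * b ^ ρ * J * V) ≤ D₀ := by
        calc r ^ N * (a ^ ρ * b ^ ρ * J * V) ≤ r ^ N * (C₀ * L ^ ρ * V) := by gcongr
          _ ≤ r ^ N * (C₀ * (c * r) ^ ρ * V) := by gcongr
          _ = C₀ * c ^ ρ * (r ^ (N + ρ) * V) := by rw [mul_pow, pow_add]; ring
          _ ≤ D₀ := by rw [hD₀]; gcongr
      linarith
    · have hVb : V ≤ G * (r ^ (2 * M) * a ^ M * b ^ M) := by
        have e1 : 1 + ‖y + X‖ ≤ A * r * a := by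
          refine (one_add_norm_le_mul X (y + X)).trans ?_
          rw [add_sub_cancel_right]
          gcongr
        have e2 : 1 + ‖(2 * Real.pi) • ω + ζ‖ ≤ 7 * A * r * b := by
          refine (one_add_norm_le_mul ζ _).trans ?_
          have e4 : ‖(2 * Real.pi) • ω‖ = 2 * Real.pi * ‖ω‖ := by
            rw [norm_smul, Real.norm_of_nonneg (by positivity)]
          rw [add_sub_cancel_right, e4]
          have e3 : 1 + 2 * Real.pi * ‖ω‖ ≤ 7 * b := by
            rw [hb]
            nlinarith [norm_nonneg ω, Real.pi_lt_d2]
          calc (1 + ‖ζ‖) * (1 + 2 * Real.pi * ‖ω‖) ≤ (A * s) * (7 * b) := by gcongr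
            _ ≤ (A * r) * (7 * b) := by gcongr
            _ = _ := by ring
        calc V ≤ Cu * (1 + ‖y + X‖) ^ M * (1 + ‖(2 * Real.pi) • ω + ζ‖) ^ M := hu _ _
          _ ≤ Cu * (A * r * a) ^ M * (7 * A * r * b) ^ M := by gcongr
          _ = _ := by
            rw [hG, mul_pow (A * r) a, mul_pow (7 * A * r) b, mul_pow A r, mul_pow (7 * A) r,
              show 2 * M = M + M by ring, pow_add]
            ring
      have hred : r ^ N * (a ^ ρ * b ^ ρ * J * V) ≤ G * (r ^ E * (a ^ K * b ^ K * J)) := by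
        calc r ^ N * (a ^ ρ * b ^ ρ * J * V)
            ≤ r ^ N * (a ^ ρ * b ^ ρ * J * (G * (r ^ (2 * M) * a ^ M * b ^ M))) := by gcongr
          _ = _ := by rw [hE, hK, pow_add, pow_add, pow_add]; ring
      have hG0 : 0 ≤ G := by positivity
      rw [not_and_or, not_lt, not_lt] at hnear
      rcases hnear with hfar | hfar
      · have h5 := h₁ t le_rfl ζ ω y
        rw [← hJ, ← ha, ← hb, ← hL] at h5
        have h6 := mul_le_of_far_position hr hs1 hL0 ha1 (by linarith) hJ0 hc0 hδ hC₁ hLs hsk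
          (by linarith) h5
        have h7 : r ^ N * (a ^ ρ * b ^ ρ * J * V) ≤ D₁ :=
          hred.trans (mul_le_mul_of_nonneg_left h6 hG0)
        linarith
      · have h5 := h₂ t le_rfl ζ ω y
        rw [← hJ, ← ha, ← hb, ← hL] at h5
        have hfar' : δ / 7 * s ≤ b := by
          rw [norm_smul, Real.norm_of_nonneg (by positivity)] at hfar
          have : 2 * Real.pi * ‖ω‖ ≤ 7 * ‖ω‖ := by
            gcongr
            linarith [Real.pi_lt_d2]
          rw [hb]
          linarith [norm_nonneg ω]
        have h6 := mul_le_of_far_frequency hr hs1 hL0 (by linarith) hb1 hJ0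
          (by positivity : 0 < δ / 7) hC₂ hLs hsk hfar' h5
        have h7 : r ^ N * (a ^ ρ * b ^ ρ * J * V) ≤ D₂ :=
          hred.trans (mul_le_mul_of_nonneg_left h6 hG0)
        linarith

/-- The limit hypothesis says that rescaled backward trajectories from a neighbourhood of `z₀` end
up near `w₀` for all large scales, uniformly. Bounded scales are harmless by the polynomial growth
of the transform. -/
theorem not_mem_gaborWF_propagator {p q : Fin d → ℝ[X]}
    (hq : ∀ j, Polynomial.derivative (q j) = p j) (hm : 2 ≤ order p) (v : Rd d) (t : ℝ)
    {φ : 𝓢(Rd d, ℂ)} (hφ : φ ≠ 0) (ψ : 𝓢(Rd d, ℂ)) (u : 𝓢'(Rd d, ℂ)) {σ : ℝ} (hσ : 0 < σ)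
    (hσm : σ * ((order p : ℝ) - 1) ≤ 1) {z₀ w₀ : Rd d × Rd d} (hz₀ : z₀ ≠ 0) (hw₀ : w₀ ≠ 0)
    (hlim : Tendsto (fun P : (Rd d × Rd d) × ℝ =>
      (P.1.1 + P.2⁻¹ • gradPhase p v t (P.2 ^ σ • P.1.2 + t • v),
        P.1.2 + (P.2 ^ σ)⁻¹ • (t • v))) (𝓝 z₀ ×ˢ atTop) (𝓝 w₀))
    (hw : w₀ ∉ gaborWF σ φ u) : z₀ ∉ gaborWF σ ψ (propagator q v t u) := by
  rw [not_mem_gaborWF_iff hw₀] at hw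
  rw [not_mem_gaborWF_iff hz₀]
  obtain ⟨U, hUo, hUw, hU⟩ := hw
  obtain ⟨ε, hε, hεU⟩ := Metric.isOpen_iff.1 hUo w₀ hUw
  set δ := ε / 2 with hδdef
  have hδ : 0 < δ := by positivity
  have hev := hlim.eventually (Metric.ball_mem_nhds w₀ hδ)
  rw [eventually_prod_iff] at hev
  obtain ⟨P₁, hP₁, P₂, hP₂, hP⟩ := hev
  obtain ⟨R₀, hR₀⟩ := eventually_atTop.1 hP₂
  obtain ⟨U₁, hU₁, hU₁o, hU₁z⟩ := eventually_nhds_iff.1 hP₁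
  set R := max R₀ 1 with hR
  have hR1 : 1 ≤ R := le_max_right _ _
  refine ⟨U₁ ∩ Metric.ball z₀ 1, hU₁o.inter Metric.isOpen_ball,
    ⟨hU₁z, Metric.mem_ball_self one_pos⟩, fun N => ?_⟩
  obtain ⟨C, hC⟩ := exists_pow_mul_norm_stft_propagator_le hq hm v t hφ ψ u hσ hσm hδ
    (fun N => by
      obtain ⟨C, hC⟩ := hU N
      refine ⟨C, fun z hz => hC z (hεU ?_)⟩
      rwa [hδdef, mul_div_cancel₀ _ two_ne_zero] at hz) N
  obtain ⟨C', M, hC', h'⟩ := exists_norm_stft_le ψ (propagator q v t u)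
  set B : ℝ := R ^ N * (C' * (1 + R * (‖z₀‖ + 1)) ^ M * (1 + R ^ σ * (‖z₀‖ + 1)) ^ M) with hB
  refine ⟨max C B, fun z hz r hr => ?_⟩
  rcases le_or_gt R r with hRr | hRr
  · refine le_max_of_le_left ?_
    have hr1 : 1 ≤ r := hR1.trans hRr
    have hs0 : 0 < r ^ σ := Real.rpow_pos_of_pos hr σ
    have hmem := hP (hU₁ z hz.1) (hR₀ r ((le_max_left _ _).trans hRr))
    refine hC _ _ r hr1 _ hmem ?_ ?_
    · simp only
      rw [smul_add, smul_smul, mul_inv_cancel₀ hr.ne', one_smul]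
    · simp only
      rw [smul_add, smul_smul, mul_inv_cancel₀ hs0.ne', one_smul]
  · refine le_max_of_le_right ?_
    have hz1 : ‖z‖ ≤ ‖z₀‖ + 1 := by
      have h1 : ‖z - z₀‖ < 1 := by rw [← dist_eq_norm]; exact hz.2
      have h2 : ‖z‖ ≤ ‖z - z₀‖ + ‖z₀‖ := by simpa using norm_add_le (z - z₀) z₀
      linarith
    have hz2 : ‖r • z.1‖ ≤ R * (‖z₀‖ + 1) := by
      rw [norm_smul, Real.norm_of_nonneg hr.le]
      gcongr
      exact (norm_fst_le z).trans hz1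
    have hz3 : ‖r ^ σ • z.2‖ ≤ R ^ σ * (‖z₀‖ + 1) := by
      rw [norm_smul, Real.norm_of_nonneg (by positivity)]
      gcongr
      exact (norm_snd_le z).trans hz1
    calc r ^ N * ‖stft ψ (propagator q v t u) (r • z.1) (r ^ σ • z.2)‖
        ≤ R ^ N * (C' * (1 + ‖r • z.1‖) ^ M * (1 + ‖r ^ σ • z.2‖) ^ M) := by
          gcongr
          exact h' _ _
      _ ≤ B := by rw [hB]; gcongr

end

section

variable {d : ℕ}

/-! ### Asymptotics of the gradient of the phase -/

/-- The right side is polynomial in `a` and `s⁻¹`, so it extends continuously to `s⁻¹ = 0`. -/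
theorem inv_pow_mul_pow_sub_pow {s a h : ℝ} (hs : s ≠ 0) {k m : ℕ} (hk : k ≤ m) :
    (s ^ (m - 1))⁻¹ * ((s * a) ^ k - (s * a + h) ^ k) =
      s⁻¹ ^ (m - k) * (-h * ∑ i ∈ Finset.range k, a ^ i * (a + h * s⁻¹) ^ (k - 1 - i)) := by
  obtain _ | k := k
  · simp
  obtain ⟨e, rfl⟩ := Nat.exists_eq_add_of_le hk
  have hg := geom_sum₂_mul a (a + h * s⁻¹) (k + 1)
  have h1 : (s * a) ^ (k + 1) - (s * a + h) ^ (k + 1) =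
      s ^ (k + 1) * (a ^ (k + 1) - (a + h * s⁻¹) ^ (k + 1)) := by
    rw [mul_sub, ← mul_pow, ← mul_pow]
    congr 2
    field_simp
  rw [h1, ← hg, show k + 1 + e - (k + 1) = e by omega, show k + 1 + e - 1 = k + e by omega]
  set S := ∑ i ∈ Finset.range (k + 1), a ^ i * (a + h * s⁻¹) ^ (k + 1 - 1 - i)
  rw [pow_add, pow_succ, inv_pow]
  field_simp
  ring

/-- At `s⁻¹ = 0` every monomial of degree below `m` carries a positive power of zero. Components of
degree less than `m` are covered too, since their coefficient of order `m` vanishes. -/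
theorem tendsto_scaled_eval_sub {P : ℝ[X]} {m : ℕ} (hP : P.natDegree ≤ m) (h a₀ : ℝ) :
    Tendsto (fun x : ℝ × ℝ => (x.2 ^ (m - 1))⁻¹ * (P.eval (x.2 * x.1) - P.eval (x.2 * x.1 + h)))
      (𝓝 a₀ ×ˢ atTop) (𝓝 (-h * (P.coeff m * (m * a₀ ^ (m - 1))))) := by
  let Q : ℝ × ℝ → ℝ := fun x => ∑ k ∈ Finset.range (m + 1), P.coeff k *
    (x.2 ^ (m - k) * (-h * ∑ i ∈ Finset.range k, x.1 ^ i * (x.1 + h * x.2) ^ (k - 1 - i)))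
  have hQ : Continuous Q := by fun_prop
  have hQ0 : Q (a₀, 0) = -h * (P.coeff m * (m * a₀ ^ (m - 1))) := by
    simp only [Q]
    rw [Finset.sum_range_succ, Finset.sum_eq_zero]
    · have : ∑ i ∈ Finset.range m, a₀ ^ i * (a₀ + h * 0) ^ (m - 1 - i) = m * a₀ ^ (m - 1) := by
        rw [Finset.sum_congr rfl (g := fun _ => a₀ ^ (m - 1)), Finset.sum_const,
          Finset.card_range, nsmul_eq_mul]
        intro i hi
        rw [mul_zero, add_zero, ← pow_add]
        congr 1
        have := Finset.mem_range.1 hi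
        omega
      rw [this]
      simp
      ring
    · intro k hk
      rw [zero_pow (by have := Finset.mem_range.1 hk; omega)]
      ring
  have h1 : Tendsto (fun x : ℝ × ℝ => (x.1, x.2⁻¹)) (𝓝 a₀ ×ˢ atTop) (𝓝 (a₀, 0)) := by
    rw [nhds_prod_eq]
    exact tendsto_fst.prodMk (tendsto_inv_atTop_zero.comp tendsto_snd)
  have h2 := (hQ.tendsto (a₀, 0)).comp h1
  rw [hQ0] at h2
  refine h2.congr' ?_
  have hpos : ∀ᶠ x : ℝ × ℝ in 𝓝 a₀ ×ˢ atTop, 0 < x.2 :=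
    tendsto_snd.eventually (eventually_gt_atTop 0)
  filter_upwards [hpos] with x hx
  simp only [Function.comp_apply, Q]
  rw [Polynomial.eval_eq_sum_range' (n := m + 1) (by omega),
    Polynomial.eval_eq_sum_range' (n := m + 1) (by omega), ← Finset.sum_sub_distrib,
    Finset.mul_sum]
  refine Finset.sum_congr rfl fun k hk => ?_
  rw [← inv_pow_mul_pow_sub_pow hx.ne' (Nat.lt_succ_iff.1 (Finset.mem_range.1 hk))]
  ring

/-- The gradient of the principal part, in coordinates. -/
def principalGrad (p : Fin d → ℝ[X]) (ξ : Rd d) : Rd d :=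
  WithLp.toLp 2 fun j => (p j).coeff (order p) * (order p * ξ j ^ (order p - 1))

theorem principalPart_eq_sum (p : Fin d → ℝ[X]) (ξ : Rd d) :
    principalPart p ξ = ∑ j, (p j).coeff (order p) * ξ j ^ order p := by
  rw [principalPart]
  refine Finset.sum_filter_of_ne fun j _ hj => ?_
  by_contra hne
  refine hj ?_
  rw [Polynomial.coeff_eq_zero_of_natDegree_lt (lt_of_le_of_ne (natDegree_le_order p j) hne),
    zero_mul]

theorem gradient_principalPart (p : Fin d → ℝ[X]) (ξ : Rd d) :
    gradient (principalPart p) ξ = principalGrad p ξ := by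
  refine HasGradientAt.gradient ?_
  rw [hasGradientAt_iff_hasFDerivAt]
  have h1 : HasFDerivAt (fun ξ : Rd d => ∑ j, (p j).coeff (order p) * ξ j ^ order p)
      (∑ j, (p j).coeff (order p) • ((order p * ξ j ^ (order p - 1)) •
        (EuclideanSpace.proj (𝕜 := ℝ) j : Rd d →L[ℝ] ℝ))) ξ := by
    refine HasFDerivAt.fun_sum fun j _ => HasFDerivAt.const_mul ?_ _
    exact (hasDerivAt_pow (order p) (ξ j)).comp_hasFDerivAt ξ
      (EuclideanSpace.proj (𝕜 := ℝ) j : Rd d →L[ℝ] ℝ).hasFDerivAt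
  have h2 : principalPart p = fun ξ : Rd d => ∑ j, (p j).coeff (order p) * ξ j ^ order p :=
    funext (principalPart_eq_sum p)
  rw [h2]
  refine h1.congr_fderiv ?_
  ext y
  simp only [principalGrad, InnerProductSpace.toDual_apply_apply, PiLp.inner_apply, sum_apply,
    smul_apply, smul_eq_mul, RCLike.inner_apply, conj_trivial, PiLp.proj_apply]
  exact Finset.sum_congr rfl fun j _ => by ring

theorem principalGrad_zero {p : Fin d → ℝ[X]} (hm : 2 ≤ order p) :
    principalGrad p (0 : Rd d) = 0 := by
  ext j
  simp [principalGrad, zero_pow (show order p - 1 ≠ 0 by omega)]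

/-- Evaluated at `ζ = r ^ σ • ξ + t • v`, the gradient of the phase contains `p(r^σ ξ) - p(r^σ ξ +
tv)`, of size `r ^ (σ(m-1))`; hence the sign and the factor `κ`. Convergence is joint in the base
point and the scale, as the openness in the definition of the wave front set requires. -/
theorem tendsto_flow {p : Fin d → ℝ[X]} {v : Rd d} (hv : ∀ j, v j ≠ 0) (t : ℝ) {σ κ : ℝ}
    (hσ : 0 < σ) (hκ : Tendsto (fun r : ℝ => (r ^ σ) ^ (order p - 1) * r⁻¹) atTop (𝓝 κ))
    (z₀ : Rd d × Rd d) :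
    Tendsto (fun P : (Rd d × Rd d) × ℝ =>
      (P.1.1 + P.2⁻¹ • gradPhase p v t (P.2 ^ σ • P.1.2 + t • v),
        P.1.2 + (P.2 ^ σ)⁻¹ • (t • v))) (𝓝 z₀ ×ˢ atTop)
      (𝓝 (z₀.1 - (κ * t) • principalGrad p z₀.2, z₀.2)) := by
  have hσt : Tendsto (fun P : (Rd d × Rd d) × ℝ => P.2 ^ σ) (𝓝 z₀ ×ˢ atTop) atTop :=
    (tendsto_rpow_atTop hσ).comp tendsto_snd
  have hf : Tendsto (fun P : (Rd d × Rd d) × ℝ => P.1.1) (𝓝 z₀ ×ˢ atTop) (𝓝 z₀.1) :=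
    (continuous_fst.tendsto z₀).comp tendsto_fst
  have hs : Tendsto (fun P : (Rd d × Rd d) × ℝ => P.1.2) (𝓝 z₀ ×ˢ atTop) (𝓝 z₀.2) :=
    (continuous_snd.tendsto z₀).comp tendsto_fst
  refine Tendsto.prodMk_nhds ?_ ?_
  · rw [sub_eq_add_neg]
    refine hf.add ?_
    have hj : ∀ j, Tendsto (fun P : (Rd d × Rd d) × ℝ =>
        P.2⁻¹ * ((v j)⁻¹ * ((p j).eval (P.2 ^ σ * P.1.2 j) -
          (p j).eval (P.2 ^ σ * P.1.2 j + t * v j)))) (𝓝 z₀ ×ˢ atTop)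
        (𝓝 (-(κ * t * ((p j).coeff (order p) * (order p * z₀.2 j ^ (order p - 1)))))) := by
      intro j
      have hc : Tendsto (fun P : (Rd d × Rd d) × ℝ => (P.1.2 j, P.2 ^ σ)) (𝓝 z₀ ×ˢ atTop)
          (𝓝 (z₀.2 j) ×ˢ atTop) :=
        Tendsto.prodMk (((EuclideanSpace.proj (𝕜 := ℝ) j : Rd d →L[ℝ] ℝ).continuous.tendsto
          z₀.2).comp hs) hσt
      have h1 := (tendsto_scaled_eval_sub (natDegree_le_order p j) (t * v j) (z₀.2 j)).comp hc
      have h2 := ((hκ.comp (tendsto_snd (f := 𝓝 z₀))).mul h1).const_mul (v j)⁻¹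
      have hval : (v j)⁻¹ * (κ * (-(t * v j) *
          ((p j).coeff (order p) * (order p * z₀.2 j ^ (order p - 1))))) =
          -(κ * t * ((p j).coeff (order p) * (order p * z₀.2 j ^ (order p - 1)))) := by
        have := hv j
        field_simp
      rw [hval] at h2
      refine h2.congr' ?_
      have hpos : ∀ᶠ P : (Rd d × Rd d) × ℝ in 𝓝 z₀ ×ˢ atTop, 0 < P.2 :=
        tendsto_snd.eventually (eventually_gt_atTop 0)
      filter_upwards [hpos] with P hP
      have hs0 : P.2 ^ σ ≠ 0 := (Real.rpow_pos_of_pos hP σ).ne'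
      simp only [Function.comp_apply]
      field_simp
    have hpi := tendsto_pi_nhds.2 hj
    have h3 := ((PiLp.continuous_toLp 2 (fun _ : Fin d => ℝ)).tendsto _).comp hpi
    refine (h3.congr fun P => ?_).trans (le_of_eq ?_)
    · ext j
      simp [gradPhase]
    · congr 1
  · have h0 : Tendsto (fun P : (Rd d × Rd d) × ℝ => (P.2 ^ σ)⁻¹ • (t • v)) (𝓝 z₀ ×ˢ atTop)
        (𝓝 ((0 : ℝ) • (t • v))) := (tendsto_inv_atTop_zero.comp hσt).smul_const _
    simpa using hs.add h0

/-! ### Propagation of the wave front set -/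

/-- The flow `(x, ξ) ↦ (x + s ∇P_m(ξ), ξ)`. -/
def shiftFlow (p : Fin d → ℝ[X]) (s : ℝ) (z : Rd d × Rd d) : Rd d × Rd d :=
  (z.1 + s • principalGrad p z.2, z.2)

theorem shiftFlow_neg_shiftFlow (p : Fin d → ℝ[X]) (s : ℝ) (z : Rd d × Rd d) :
    shiftFlow p s (shiftFlow p (-s) z) = z := by
  simp [shiftFlow]

/-- The flow preserves `ξ`, and fixes points with `ξ = 0` because `∇P_m(0) = 0` when `m ≥ 2`. -/
theorem shiftFlow_ne_zero {p : Fin d → ℝ[X]} (hm : 2 ≤ order p) (s : ℝ) {z : Rd d × Rd d}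
    (hz : z ≠ 0) : shiftFlow p s z ≠ 0 := by
  intro h
  refine hz ?_
  have h2 : z.2 = 0 := congrArg Prod.snd h
  have h1 : z.1 + s • principalGrad p z.2 = 0 := congrArg Prod.fst h
  rw [h2, principalGrad_zero hm, smul_zero, add_zero] at h1
  exact Prod.ext h1 h2

theorem shiftFlow_mem_gaborWF {p q : Fin d → ℝ[X]} {v : Rd d} (hv : ∀ j, v j ≠ 0)
    (hm : 2 ≤ order p) (hq : ∀ j, Polynomial.derivative (q j) = p j) {σ κ : ℝ} (hσ : 0 < σ)
    (hσm : σ * ((order p : ℝ) - 1) ≤ 1)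
    (hκ : Tendsto (fun r : ℝ => (r ^ σ) ^ (order p - 1) * r⁻¹) atTop (𝓝 κ))
    {φ : 𝓢(Rd d, ℂ)} (hφ : φ ≠ 0) (ψ : 𝓢(Rd d, ℂ)) (t : ℝ) (u : 𝓢'(Rd d, ℂ))
    {z : Rd d × Rd d} (hz : z ∈ gaborWF σ ψ (propagator q v t u)) :
    shiftFlow p (-(κ * t)) z ∈ gaborWF σ φ u := by
  by_contra hw
  have hlim := tendsto_flow (p := p) hv t hσ hκ z
  have e : (z.1 - (κ * t) • principalGrad p z.2, z.2) = shiftFlow p (-(κ * t)) z := by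
    simp [shiftFlow, sub_eq_add_neg]
  rw [e] at hlim
  exact not_mem_gaborWF_propagator hq hm v t hφ ψ u hσ hσm hz.1 (shiftFlow_ne_zero hm _ hz.1)
    hlim hw hz

theorem gaborWF_propagator {p q : Fin d → ℝ[X]} {v : Rd d} (hv : ∀ j, v j ≠ 0)
    (hm : 2 ≤ order p) (hq : ∀ j, Polynomial.derivative (q j) = p j) {σ κ : ℝ} (hσ : 0 < σ)
    (hσm : σ * ((order p : ℝ) - 1) ≤ 1)
    (hκ : Tendsto (fun r : ℝ => (r ^ σ) ^ (order p - 1) * r⁻¹) atTop (𝓝 κ))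
    {φ ψ : 𝓢(Rd d, ℂ)} (hφ : φ ≠ 0) (hψ : ψ ≠ 0) (t : ℝ) (u : 𝓢'(Rd d, ℂ)) :
    gaborWF σ ψ (propagator q v t u) = shiftFlow p (κ * t) '' gaborWF σ φ u := by
  refine Set.Subset.antisymm (fun z hz => ?_) ?_
  · exact ⟨_, shiftFlow_mem_gaborWF hv hm hq hσ hσm hκ hφ ψ t u hz,
      shiftFlow_neg_shiftFlow p _ z⟩
  · rintro _ ⟨z, hz, rfl⟩
    -- The reverse inclusion is the first one at time `-t`, with the two windows exchanged.
    have e : propagator q v (-t) (propagator q v t u) = u := by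
      rw [propagator_propagator, add_neg_cancel, propagator_zero]
    rw [← e] at hz
    simpa using shiftFlow_mem_gaborWF hv hm hq hσ hσm hκ hψ φ (-t) _ hz

theorem gaborWF_propagator_critical {p q : Fin d → ℝ[X]} {v : Rd d} (hv : ∀ j, v j ≠ 0)
    (hm : 2 ≤ order p) (hq : ∀ j, Polynomial.derivative (q j) = p j)
    {φ ψ : 𝓢(Rd d, ℂ)} (hφ : φ ≠ 0) (hψ : ψ ≠ 0) (t : ℝ) (u : 𝓢'(Rd d, ℂ)) :
    gaborWF (1 / ((order p : ℝ) - 1)) ψ (propagator q v t u) =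
      hamiltonFlow p t '' gaborWF (1 / ((order p : ℝ) - 1)) φ u := by
  have hm' : (0 : ℝ) < (order p : ℝ) - 1 := by
    have : (2 : ℝ) ≤ order p := by exact_mod_cast hm
    linarith
  have hκ : Tendsto (fun r : ℝ => (r ^ (1 / ((order p : ℝ) - 1))) ^ (order p - 1) * r⁻¹) atTop
      (𝓝 1) := by
    refine tendsto_const_nhds.congr' ?_
    filter_upwards [eventually_gt_atTop 0] with r hr
    rw [← Real.rpow_natCast, ← Real.rpow_mul hr.le, Nat.cast_sub (by omega), Nat.cast_one,
      one_div_mul_cancel hm'.ne', Real.rpow_one, mul_inv_cancel₀ hr.ne']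
  rw [gaborWF_propagator hv hm hq (by positivity) (one_div_mul_cancel hm'.ne').le hκ hφ hψ t u]
  congr 1
  funext z
  rw [shiftFlow, hamiltonFlow, gradient_principalPart, one_mul]

theorem gaborWF_propagator_subcritical {p q : Fin d → ℝ[X]} {v : Rd d} (hv : ∀ j, v j ≠ 0)
    (hm : 2 ≤ order p) (hq : ∀ j, Polynomial.derivative (q j) = p j) {σ : ℝ} (hσ : 0 < σ)
    (hσm : σ < 1 / ((order p : ℝ) - 1)) {φ ψ : 𝓢(Rd d, ℂ)} (hφ : φ ≠ 0) (hψ : ψ ≠ 0) (t : ℝ)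
    (u : 𝓢'(Rd d, ℂ)) :
    gaborWF σ ψ (propagator q v t u) = gaborWF σ φ u := by
  have hm' : (0 : ℝ) < (order p : ℝ) - 1 := by
    have : (2 : ℝ) ≤ order p := by exact_mod_cast hm
    linarith
  have h1 : σ * ((order p : ℝ) - 1) < 1 := (lt_div_iff₀ hm').1 hσm
  have hκ : Tendsto (fun r : ℝ => (r ^ σ) ^ (order p - 1) * r⁻¹) atTop (𝓝 0) := by
    refine (tendsto_rpow_neg_atTop (show 0 < 1 - σ * ((order p : ℝ) - 1) by linarith)).congr' ?_
    filter_upwards [eventually_gt_atTop 0] with r hr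
    rw [← Real.rpow_natCast, ← Real.rpow_mul hr.le, Nat.cast_sub (by omega), Nat.cast_one,
      ← Real.rpow_neg_one r, ← Real.rpow_add hr]
    congr 1
    ring
  rw [gaborWF_propagator hv hm hq hσ h1.le hκ hφ hψ t u]
  convert Set.image_id _
  funext z
  simp [shiftFlow]

end

section

variable {d : ℕ}

/-! ### The evolution equation -/

/-- The transpose `i ∂_j` of `D_j`, on Schwartz functions. -/
def opDS (j : Fin d) (f : 𝓢(Rd d, ℂ)) : 𝓢(Rd d, ℂ) :=
  Complex.I • ∂_{(EuclideanSpace.single j (1 : ℝ) : Rd d)} f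

/-- The transpose of the Hamiltonian, on Schwartz functions. -/
def hamiltonianS (p : Fin d → ℝ[X]) (v : Rd d) (f : 𝓢(Rd d, ℂ)) : 𝓢(Rd d, ℂ) :=
  (∑ j, (p j).sum fun k c => (c : ℂ) • (opDS j)^[k] f) +
    SchwartzMap.smulLeftCLM ℂ (fun x : Rd d => ((inner ℝ v x : ℝ) : ℂ)) f

theorem opD_apply (j : Fin d) (u : 𝓢'(Rd d, ℂ)) (f : 𝓢(Rd d, ℂ)) :
    opD j u f = u (opDS j f) := by
  have h1 : opD j u f = (-Complex.I) * u (-∂_{(EuclideanSpace.single j (1 : ℝ) : Rd d)} f) := rfl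
  rw [h1, opDS, map_neg, map_smul, smul_eq_mul]
  ring

theorem opD_iterate_apply (j : Fin d) (k : ℕ) (u : 𝓢'(Rd d, ℂ)) (f : 𝓢(Rd d, ℂ)) :
    (opD j)^[k] u f = u ((opDS j)^[k] f) := by
  induction k generalizing u with
  | zero => rfl
  | succ k ih => rw [Function.iterate_succ_apply, ih, opD_apply, Function.iterate_succ_apply']

theorem hamiltonian_apply (p : Fin d → ℝ[X]) (v : Rd d) (u : 𝓢'(Rd d, ℂ)) (f : 𝓢(Rd d, ℂ)) :
    hamiltonian p v u f = u (hamiltonianS p v f) := by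
  have h1 : hamiltonian p v u f = (∑ j, ∑ k ∈ (p j).support, ((p j).coeff k : ℂ) •
      (opD j)^[k] u) f +
        u (SchwartzMap.smulLeftCLM ℂ (fun x : Rd d => ((inner ℝ v x : ℝ) : ℂ)) f) :=
    rfl
  rw [h1, hamiltonianS, map_add, map_sum]
  congr 1
  simp only [Polynomial.sum_def, map_sum, map_smul, ← opD_iterate_apply]
  simp

theorem fourierInv_opDS (j : Fin d) (f : 𝓢(Rd d, ℂ)) (η : Rd d) :
    𝓕⁻ (opDS j f) η = ((2 * Real.pi * η j : ℝ) : ℂ) * 𝓕⁻ f η := by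
  have hg : (fun x : Rd d => (inner ℝ x (EuclideanSpace.single j (1 : ℝ)) :
      ℝ)).HasTemperateGrowth := by fun_prop
  rw [opDS, FourierTransform.fourierInv_smul, SchwartzMap.fourierInv_lineDerivOp_eq,
    smul_apply, smul_apply, SchwartzMap.smulLeftCLM_apply_apply hg]
  rw [EuclideanSpace.inner_single_right]
  simp only [smul_eq_mul, Complex.real_smul, one_mul, conj_trivial]
  push_cast
  linear_combination (2 * Real.pi * η j * 𝓕⁻ f η) * (-Complex.I_mul_I)

theorem fourierInv_opDS_iterate (j : Fin d) (k : ℕ) (f : 𝓢(Rd d, ℂ)) (η : Rd d) :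
    𝓕⁻ ((opDS j)^[k] f) η = ((2 * Real.pi * η j : ℝ) : ℂ) ^ k * 𝓕⁻ f η := by
  induction k with
  | zero => simp
  | succ k ih => rw [Function.iterate_succ_apply', fourierInv_opDS, ih, pow_succ]; ring

theorem lineDeriv_fourierInv (v : Rd d) (f : 𝓢(Rd d, ℂ)) (η : Rd d) :
    fderiv ℝ (⇑(𝓕⁻ f : 𝓢(Rd d, ℂ))) η v = (2 * Real.pi * Complex.I) *
      𝓕⁻ (SchwartzMap.smulLeftCLM ℂ (fun x : Rd d => ((inner ℝ v x : ℝ) : ℂ)) f) η := by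
  have hg : (fun x : Rd d => (inner ℝ x v : ℝ)).HasTemperateGrowth := by fun_prop
  have h1 : SchwartzMap.smulLeftCLM ℂ (fun x : Rd d => ((inner ℝ v x : ℝ) : ℂ)) f =
      SchwartzMap.smulLeftCLM ℂ (fun x : Rd d => (inner ℝ x v : ℝ)) f := by
    rw [← SchwartzMap.smulLeftCLM_ofReal ℂ hg]
    simp only [real_inner_comm]
    rfl
  rw [← SchwartzMap.lineDerivOp_apply_eq_fderiv, SchwartzMap.lineDerivOp_fourierInv_eq, h1,
    FourierTransform.fourierInv_smul, smul_apply, smul_eq_mul]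

theorem fourierInv_hamiltonianS (p : Fin d → ℝ[X]) (v : Rd d) (f : 𝓢(Rd d, ℂ)) (η : Rd d) :
    (2 * Real.pi * Complex.I) * 𝓕⁻ (hamiltonianS p v f) η =
      (2 * Real.pi * Complex.I) * ((∑ j, (p j).eval (2 * Real.pi * η j) : ℝ) : ℂ) * 𝓕⁻ f η +
        fderiv ℝ (⇑(𝓕⁻ f : 𝓢(Rd d, ℂ))) η v := by
  have h1 : 𝓕⁻ (hamiltonianS p v f) η =
      (∑ j, ∑ k ∈ (p j).support, ((p j).coeff k : ℂ) * 𝓕⁻ ((opDS j)^[k] f) η) +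
      𝓕⁻ (SchwartzMap.smulLeftCLM ℂ (fun x : Rd d => ((inner ℝ v x : ℝ) : ℂ)) f) η := by
    let A : 𝓢(Rd d, ℂ) →L[ℂ] ℂ :=
      (toCLM (TemperedDistribution.delta η)).comp (FourierTransform.fourierInvCLM ℂ 𝓢(Rd d, ℂ))
    have hA : ∀ g, A g = 𝓕⁻ g η := fun g => rfl
    simp only [← hA]
    rw [hamiltonianS, map_add, map_sum]
    simp only [Polynomial.sum_def, map_sum, map_smul, smul_eq_mul]
  rw [lineDeriv_fourierInv, h1]
  simp only [fourierInv_opDS_iterate, Polynomial.eval_eq_sum, Polynomial.sum_def]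
  push_cast
  simp only [mul_add, mul_assoc, Finset.sum_mul]

theorem hasDerivAt_phase {p q : Fin d → ℝ[X]} {v : Rd d} (hv : ∀ j, v j ≠ 0)
    (hq : ∀ j, Polynomial.derivative (q j) = p j) (ξ : Rd d) (t : ℝ) :
    HasDerivAt (fun t => phase q v t ξ) (-∑ j, (p j).eval (ξ j - t * v j)) t := by
  unfold phase
  rw [← Finset.sum_neg_distrib]
  refine HasDerivAt.fun_sum fun j _ => ?_
  have h1 : HasDerivAt (fun t : ℝ => ξ j - t * v j) (-v j) t := by
    simpa using ((hasDerivAt_id t).mul_const (v j)).const_sub (ξ j)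
  have h2 := ((((q j).hasDerivAt (ξ j - t * v j)).comp t h1).sub_const
    ((q j).eval (ξ j))).const_mul (v j)⁻¹
  rw [hq] at h2
  refine h2.congr_deriv ?_
  have := hv j
  field_simp

/-- The symbol contributes `-i ∑ p_j` at the translated frequency `η'`, and the translation
contributes a derivative along `v`, which is multiplication by `⟨v, x⟩` on the other side. Their sum
is the transposed Hamiltonian. -/
theorem hasDerivAt_fourierInv_propagatorS {p q : Fin d → ℝ[X]} {v : Rd d} (hv : ∀ j, v j ≠ 0)
    (hq : ∀ j, Polynomial.derivative (q j) = p j) (f : 𝓢(Rd d, ℂ)) (η : Rd d) (t : ℝ) :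
    HasDerivAt (fun t => 𝓕⁻ (propagatorS q v t f) η)
      (-(Complex.I * 𝓕⁻ (propagatorS q v t (hamiltonianS p v f)) η)) t := by
  simp only [fourierInv_propagatorS_apply]
  have hpi : (2 * Real.pi) ≠ 0 := by positivity
  set η' := η - (2 * Real.pi)⁻¹ • (t • v) with hη'
  have h1 : HasDerivAt (fun t => symbol q v t η)
      (symbol q v t η * (((-∑ j, (p j).eval (((2 * Real.pi) • η) j - t * v j) : ℝ) : ℂ) *
        Complex.I)) t :=
    (((hasDerivAt_phase hv hq ((2 * Real.pi) • η) t).ofReal_comp).mul_const Complex.I).cexp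
  have h2 : HasDerivAt (fun t : ℝ => η - (2 * Real.pi)⁻¹ • (t • v))
      (-((2 * Real.pi)⁻¹ • v)) t := by
    simpa using (((hasDerivAt_id t).smul_const v).const_smul (2 * Real.pi)⁻¹).const_sub η
  have h3 := ((𝓕⁻ f).hasFDerivAt η').comp_hasDerivAt t h2
  refine (h1.mul h3).congr_deriv ?_
  have hcoord : ∀ j, ((2 * Real.pi) • η) j - t * v j = 2 * Real.pi * η' j := by
    intro j
    simp [hη']
    field_simp
  simp only [hcoord]
  have h4 := fourierInv_hamiltonianS p v f η'
  rw [map_neg, map_smul, Complex.real_smul, Function.comp_apply, ← hη']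
  have hpi' : (2 * (Real.pi : ℂ)) ≠ 0 := by exact_mod_cast hpi
  set S : ℂ := symbol q v t η
  set D : ℂ := fderiv ℝ (⇑(𝓕⁻ f : 𝓢(Rd d, ℂ))) η' v
  set H : ℂ := 𝓕⁻ (hamiltonianS p v f) η'
  have hD : D = (2 * Real.pi * Complex.I) * H - (2 * Real.pi * Complex.I) *
      ((∑ j, (p j).eval (2 * Real.pi * η' j) : ℝ) : ℂ) * 𝓕⁻ f η' := by
    rw [h4]; ring
  rw [hD]
  push_cast
  field_simp
  ring

theorem hasDerivAt_pairCLM_propagatorS {p q : Fin d → ℝ[X]} {v : Rd d} (hv : ∀ j, v j ≠ 0)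
    (hq : ∀ j, Polynomial.derivative (q j) = p j) (f h : 𝓢(Rd d, ℂ)) (t : ℝ) :
    HasDerivAt (fun t => pairCLM (propagatorS q v t f) h)
      (-(Complex.I * pairCLM (propagatorS q v t (hamiltonianS p v f)) h)) t := by
  have e : ∀ t g, pairCLM (propagatorS q v t g) h =
      ∫ η, 𝓕⁻ (propagatorS q v t g) η * 𝓕 h η := by
    intro t g
    rw [pairCLM_propagatorS]
    simp only [fourierInv_propagatorS_apply]
  simp only [e]
  obtain ⟨K, hK0, hK⟩ : ∃ K : ℝ, 0 ≤ K ∧ ∀ η, ‖𝓕⁻ (hamiltonianS p v f) η‖ ≤ K :=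
    ⟨_, apply_nonneg _ _, fun η => (𝓕⁻ (hamiltonianS p v f)).norm_le_seminorm ℂ η⟩
  have hsym : ∀ t η, ‖symbol q v t η‖ = 1 := fun t η => Complex.norm_exp_ofReal_mul_I _
  have hc : ∀ g : 𝓢(Rd d, ℂ), Integrable fun η => g η * 𝓕 h η := fun g => by
    have := (SchwartzMap.smulLeftCLM ℂ g (𝓕 h)).integrable (μ := volume)
    refine this.congr (.of_forall fun η => ?_)
    simp [SchwartzMap.smulLeftCLM_apply_apply g.hasTemperateGrowth]
  have key := hasDerivAt_integral_of_dominated_loc_of_deriv_le (μ := volume) (x₀ := t)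
    (s := Set.univ) (bound := fun η => K * ‖𝓕 h η‖)
    (F := fun t η => 𝓕⁻ (propagatorS q v t f) η * 𝓕 h η)
    (F' := fun t η => -(Complex.I * 𝓕⁻ (propagatorS q v t (hamiltonianS p v f)) η) * 𝓕 h η)
    univ_mem (.of_forall fun t => (hc _).aestronglyMeasurable) (hc _)
    (((continuous_const.mul (𝓕⁻ (propagatorS q v t (hamiltonianS p v f))).continuous).neg.mul
      (𝓕 h).continuous).aestronglyMeasurable)
    (.of_forall fun η t _ => by
      rw [norm_mul, norm_neg, norm_mul, Complex.norm_I, one_mul, fourierInv_propagatorS_apply,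
        norm_mul, hsym, one_mul]
      gcongr
      exact hK _)
    ((𝓕 h).integrable.norm.const_mul K)
    (.of_forall fun η t _ => (hasDerivAt_fourierInv_propagatorS hv hq f η t).mul_const _)
  refine key.2.congr_deriv ?_
  rw [← integral_const_mul, ← integral_neg]
  exact integral_congr_ae (.of_forall fun η => by ring)

theorem timeFreqShift_zero (χ : 𝓢(Rd d, ℂ)) : timeFreqShift χ 0 (-0) = χ := by
  ext y
  simp [timeFreqShift_apply]

theorem exists_norm_pairCLM_mul_le {p q : Fin d → ℝ[X]}
    (hq : ∀ j, Polynomial.derivative (q j) = p j) (hm : 2 ≤ order p) (v : Rd d)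
    (f φ : 𝓢(Rd d, ℂ)) (u : 𝓢'(Rd d, ℂ)) (T : ℝ) :
    ∃ C : ℝ, ∀ t : ℝ, |t| ≤ T → ∀ z : Rd d × Rd d,
      ‖pairCLM (propagatorS q v t f) (timeFreqShift φ z.1 ((2 * Real.pi) • z.2)) *
        stft φ u z.1 ((2 * Real.pi) • z.2)‖ ≤ C * (weight z.1 * weight z.2) := by
  obtain ⟨C₁, M, hC₁, h₁⟩ := exists_norm_stft_le φ u
  set r := (volume : Measure (Rd d)).integrablePower with hr
  obtain ⟨C₂, hC₂, h₂⟩ := exists_norm_pairCLM_propagatorS_le hq hm v f φ T 0 0 (M + r)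
  rw [timeFreqShift_zero] at h₂
  refine ⟨C₁ * 7 ^ M * C₂, fun t ht z => rpow_weight_mul_ge (by positivity) (by positivity) ?_⟩
  have h3 : 1 + ‖(2 * Real.pi) • z.2‖ ≤ 7 * (1 + ‖z.2‖) := by
    rw [norm_smul, Real.norm_of_nonneg (by positivity)]
    nlinarith [norm_nonneg z.2, Real.pi_lt_d2]
  rw [norm_mul]
  set W := ‖pairCLM (propagatorS q v t f) (timeFreqShift φ z.1 ((2 * Real.pi) • z.2))‖
  calc (1 + ‖z.1‖) ^ r * (1 + ‖z.2‖) ^ r * (W * ‖stft φ u z.1 ((2 * Real.pi) • z.2)‖)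
      ≤ (1 + ‖z.1‖) ^ r * (1 + ‖z.2‖) ^ r *
          (W * (C₁ * (1 + ‖z.1‖) ^ M * (7 * (1 + ‖z.2‖)) ^ M)) := by
        gcongr
        refine (h₁ _ _).trans ?_
        gcongr
    _ = C₁ * 7 ^ M * ((1 + ‖z.1‖) ^ (M + r) * (1 + ‖z.2‖) ^ (M + r) * W) := by
        rw [mul_pow, pow_add, pow_add]; ring
    _ ≤ _ := by gcongr; exact h₂ t ht z.1 z.2

/-- Differentiability in the Schwartz topology is never needed: the inversion formula expresses the
action of `u` through scalar pairings, which are differentiated under the integral. -/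
theorem hasDerivAt_propagator {p q : Fin d → ℝ[X]} {v : Rd d} (hv : ∀ j, v j ≠ 0)
    (hm : 2 ≤ order p) (hq : ∀ j, Polynomial.derivative (q j) = p j) (u : 𝓢'(Rd d, ℂ))
    (f : 𝓢(Rd d, ℂ)) (t : ℝ) :
    HasDerivAt (fun s => propagator q v s u f)
      (-(Complex.I * hamiltonian p v (propagator q v t u) f)) t := by
  -- The test function itself serves as window below, so it has to be nonzero.
  rcases eq_or_ne f 0 with rfl | hf
  · simp only [map_zero, mul_zero, neg_zero]
    exact hasDerivAt_const t (0 : ℂ)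
  set c : ℂ := (((2 * Real.pi) ^ (-(d : ℝ) / 2) : ℝ) : ℂ) with hc
  have hc0 : c ≠ 0 := by
    rw [hc, Complex.ofReal_ne_zero]
    positivity
  have hm0 : (windowMass f : ℂ) ≠ 0 := Complex.ofReal_ne_zero.2 (windowMass_pos hf).ne'
  have hrep : ∀ s g, u (propagatorS q v s g) = (c * windowMass f)⁻¹ * ∫ z : Rd d × Rd d,
      pairCLM (propagatorS q v s g) (timeFreqShift f z.1 ((2 * Real.pi) • z.2)) *
        stft f u z.1 ((2 * Real.pi) • z.2) := by
    intro s g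
    have h1 := apply_propagatorS_eq_integral hq hm v s g f 0 0 u
    rw [timeFreqShift_zero] at h1
    rw [eq_inv_mul_iff_mul_eq₀ (mul_ne_zero hc0 hm0), mul_assoc, mul_comm (windowMass f : ℂ), h1,
      ← integral_const_mul]
    refine integral_congr_ae (.of_forall fun z => ?_)
    simp only [stft_eq]
    ring
  have hcont : ∀ s g, Continuous fun z : Rd d × Rd d =>
      pairCLM (propagatorS q v s g) (timeFreqShift f z.1 ((2 * Real.pi) • z.2)) *
        stft f u z.1 ((2 * Real.pi) • z.2) := by
    intro s g
    have h1 : Continuous ((fun z : Rd d × Rd d => stft f u z.1 z.2) ∘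
        fun z : Rd d × Rd d => (z.1, (2 * Real.pi) • z.2)) :=
      (continuous_stft f u).comp (continuous_fst.prodMk
        ((continuous_const_smul (2 * Real.pi)).comp continuous_snd))
    exact ((pairCLM (propagatorS q v s g)).continuous.comp
      (continuous_timeFreqShift_comp f _)).mul h1
  have hwi : Integrable fun z : Rd d × Rd d => weight z.1 * weight z.2 := integrable_prod_weight d
  obtain ⟨C₁, h₁⟩ := exists_norm_pairCLM_mul_le hq hm v f f u |t|
  -- The derivative must be dominated on the whole unit ball around `t`, hence the bound `|t| + 1`
  -- on times.
  obtain ⟨C₂, h₂⟩ := exists_norm_pairCLM_mul_le hq hm v (hamiltonianS p v f) f u (|t| + 1)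
  have key := hasDerivAt_integral_of_dominated_loc_of_deriv_le (𝕜 := ℝ)
    (μ := (volume : Measure (Rd d × Rd d))) (x₀ := t)
    (s := Metric.ball t 1) (bound := fun z => C₂ * (weight z.1 * weight z.2))
    (F := fun s z => pairCLM (propagatorS q v s f)
      (timeFreqShift f z.1 ((2 * Real.pi) • z.2)) * stft f u z.1 ((2 * Real.pi) • z.2))
    (F' := fun s z => -(Complex.I * pairCLM (propagatorS q v s (hamiltonianS p v f))
      (timeFreqShift f z.1 ((2 * Real.pi) • z.2))) * stft f u z.1 ((2 * Real.pi) • z.2))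
    (Metric.ball_mem_nhds t one_pos) (.of_forall fun s => (hcont s f).aestronglyMeasurable)
    ((hwi.const_mul C₁).mono' (hcont t f).aestronglyMeasurable
      (.of_forall fun z => h₁ t le_rfl z))
    ((continuous_const.mul (hcont t (hamiltonianS p v f))).congr
      (f := fun z => -Complex.I * _) (fun z => by ring)).aestronglyMeasurable
    (.of_forall fun z s hs => by
      have hs' : |s| ≤ |t| + 1 := by
        have h1 : |s - t| < 1 := by rwa [Metric.mem_ball, Real.dist_eq] at hs
        have h2 := abs_add_le (s - t) t
        rw [sub_add_cancel] at h2
        linarith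
      have h3 := h₂ s hs' z
      rw [norm_mul] at h3
      rw [norm_mul, norm_neg, norm_mul, Complex.norm_I, one_mul]
      exact h3)
    (hwi.const_mul C₂)
    (.of_forall fun z s _ => (hasDerivAt_pairCLM_propagatorS hv hq f _ s).mul_const _)
  have h4 := key.2.const_mul (c * windowMass f)⁻¹
  simp only [← hrep] at h4
  refine h4.congr_deriv ?_
  rw [hamiltonian_apply, propagator_apply, hrep t (hamiltonianS p v f), mul_left_comm,
    ← mul_neg]
  congr 1
  rw [← integral_const_mul, ← integral_neg]
  exact integral_congr_ae (.of_forall fun z => by ring)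

end

end AirySchrodinger

end

theorem theorem5p1 {d : ℕ} (p q : Fin d → Polynomial ℝ) (v : AirySchrodinger.Rd d)
    (hv : ∀ j, v j ≠ 0)
    (hm : 2 ≤ AirySchrodinger.order p)
    (hq : ∀ j, Polynomial.derivative (q j) = p j) :
    -- `K_t` is the solution operator of the evolution equation
    (∀ u₀ : 𝓢'(AirySchrodinger.Rd d, ℂ), AirySchrodinger.IsSolution p v u₀
      fun t => AirySchrodinger.propagator q v t u₀) ∧
    -- `σ = 1 / (m - 1)`
    (∀ φ ψ : 𝓢(AirySchrodinger.Rd d, ℂ), φ ≠ 0 → ψ ≠ 0 →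
      ∀ (t : ℝ) (u : 𝓢'(AirySchrodinger.Rd d, ℂ)),
        AirySchrodinger.gaborWF (1 / ((AirySchrodinger.order p : ℝ) - 1)) ψ
            (AirySchrodinger.propagator q v t u) =
          AirySchrodinger.hamiltonFlow p t ''
            AirySchrodinger.gaborWF (1 / ((AirySchrodinger.order p : ℝ) - 1)) φ u) ∧
    -- `0 < σ < 1 / (m - 1)`
    (∀ σ : ℝ, 0 < σ → σ < 1 / ((AirySchrodinger.order p : ℝ) - 1) →
      ∀ φ ψ : 𝓢(AirySchrodinger.Rd d, ℂ), φ ≠ 0 → ψ ≠ 0 →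
        ∀ (t : ℝ) (u : 𝓢'(AirySchrodinger.Rd d, ℂ)),
          AirySchrodinger.gaborWF σ ψ (AirySchrodinger.propagator q v t u) =
            AirySchrodinger.gaborWF σ φ u) := by
  refine ⟨fun u₀ => ⟨AirySchrodinger.propagator_zero q v u₀, fun t f =>
    AirySchrodinger.hasDerivAt_propagator hv hm hq u₀ f t⟩, fun φ ψ hφ hψ t u =>
    AirySchrodinger.gaborWF_propagator_critical hv hm hq hφ hψ t u, fun σ hσ hσm φ ψ hφ hψ t u =>
    AirySchrodinger.gaborWF_propagator_subcritical hv hm hq hσ hσm hφ hψ t u⟩
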